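/- **Setting.** The Earth is the sphere of radius $R_\oplus>0$ centred at the origin of $\mathbb R^3$. The typical device is at $\mathbf u_0=(0,0,R_\oplus)$. There are $K$ tiers of satellites; tier $k$ has $N_k$ satellites on the sphere of radius $R_k=R_\oplus+a_k$, $a_k>0$. Tier $m$ is legitimate, and the satellites $j=1,\dots,N_k$ of the tiers $k\ne m$ are the eavesdroppers. Fix the half beamwidth $\theta_{\rm beam}>0$, device density $\lambda_u>0$, and constants $P_t,G,c,f,\sigma^2>0$, $\gamma\in[0,1]$, $m_1\in\{1,2,\dots\}$, $m_2>0$. Put $\theta_{k,\max}=\arcsin(\tfrac{R_k}{R_\oplus}\sin\theta_{\rm beam})-\theta_{\rm beam}$ if $\theta_{\rm beam}<\arcsin(R_\oplus/R_k)$, and $\theta_{k,\max}=\arccos(R_\oplus/R_k)$ otherwise. Over a link of length $d$ with fading power gain $h$ the received power is $P_{\rm rec}=P_tG\left(\frac{c}{4\pi f d}\right)^2h$. Each eavesdropper $(k,j)$ is uniformly distributed on its sphere. The link to it from the typical device has a fading gain $h_{kj}$ of some law $\nu$. The interfering devices form a homogeneous Poisson point process of density $\lambda_u$ on the Earth's surface,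 and their fading gains to the eavesdropper are i.i.d. $\mathrm{Gamma}(m_1,m_2)$ (shape, scale). For each eavesdropper its position, $h_{kj}$, the Poisson process and the interferers' gains are mutually independent. A device is covered by a satellite of tier $k$ when their central angle is less than $\theta_{k,\max}$. Let $I_{kj}$ be the total power received at $(k,j)$ from the interfering devices it covers. With $P_{kj}$ the power received from the typical device, $$\mathrm{SINR}_{kj}=\frac{\gamma P_{kj}}{(1-\gamma)P_{kj}+I_{kj}+\sigma^2}$$ if $(k,j)$ covers the typical device, and $\mathrm{SINR}_{kj}=0$ otherwise. For a threshold $\beta_{\rm ES}>0$ with $\beta_{\rm ES}(1-\gamma)<\gamma$, let $$\mathcal P_{\rm out}=\mathbb P\Big[\max_{k\neq m}\max_{1\le j\le N_k}\mathrm{SINR}_{kj}<\beta_{\rm ES}\Big].$$ With $d_k(\theta)=\sqrt{R_\oplus^2+R_k^2-2R_\oplus R_k\cos\theta}$, put $$s_k(\theta)=\frac{(m_1!)^{-1/m_1}}{m_2}\,\frac{\beta_{\rm ES}}{[\gamma-\beta_{\rm ES}(1-\gamma)]P_tG}\Big(\frac{4\pi f d_k(\theta)}{c}\Big)^2,$$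 $$\mathcal L_k(s)=\exp\Big(-\lambda_u\int_0^{2\pi}\!\!\int_0^{\theta_{k,\max}}\Big[1-\Big(1+m_2sP_tG\Big(\frac{c}{4\pi f d_k(\theta)}\Big)^2\Big)^{-m_1}\Big]R_\oplus^2\sin\theta\,d\theta\,d\varphi\Big),$$ $$B_k=\sum_{q=0}^{m_1}\binom{m_1}{q}(-1)^q\int_0^{\theta_{k,\max}}e^{-q s_k(\theta)\sigma^2}\,\mathcal L_k(q s_k(\theta))\,\frac{\sin\theta}{2}\,d\theta+\frac{1+\cos\theta_{k,\max}}{2}.$$ **Theorem 1 (Secrecy Outage Probability).** 1. Suppose the law $\nu$ of the gains $h_{kj}$ has the distribution function $F(x)=\big[1-\exp\big(-\tfrac{(m_1!)^{-1/m_1}}{m_2}x\big)\big]^{m_1}$, $x\ge 0$, which is used to approximate that of $\mathrm{Gamma}(m_1,m_2)$. Then every eavesdropper of tier $k$ satisfies $\mathbb P[\mathrm{SINR}_{kj}<\beta_{\rm ES}]=B_k$, whatever the dependence between different eavesdroppers (in particular if all of them receive interference from one and the same Poisson process). If moreover the eavesdroppers are treated as mutually independent (the families consisting of the position, fading gains and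 interfering devices of each of them are independent), then $$\mathcal P_{\rm out}=\prod_{k\neq m}B_k^{N_k}.$$ 2. Suppose instead that $\nu$ is the law $\mathrm{Gamma}(m_1,m_2)$ itself. Then $\mathbb P[\mathrm{SINR}_{kj}<\beta_{\rm ES}]\ge B_k$ for every eavesdropper, whatever the dependence between different ones, and $\mathcal P_{\rm out}\ge\prod_{k\ne m}B_k^{N_k}$ if the eavesdroppers are mutually independent. For $m_1=1$ equality holds in both. -/

import Mathlib

open MeasureTheory ProbabilityTheory
open scoped ENNReal NNReal Nat

noncomputable section

/-- Euclidean three-space; the centre of the Earth is the origin. -/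
abbrev E3 : Type := EuclideanSpace ℝ (Fin 3)

/-! ### Surface measure, uniform points and Poisson processes on a sphere -/

/-- Surface area measure (total mass `4 π R ^ 2`) of the sphere of radius `R` centred at the origin,
regarded as a measure on the whole space. -/
def sphereArea (R : ℝ) : Measure E3 :=
  ENNReal.ofReal (R ^ 2) •
    ((volume : Measure E3).toSphere.map (fun z : Metric.sphere (0 : E3) 1 => R • (z : E3)))

/-- The uniform probability distribution on the sphere of radius `R` centred at the origin. -/
def uniformSphere (R : ℝ) : Measure E3 :=
  (sphereArea R Set.univ)⁻¹ • sphereArea R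

open Classical in
/-- The number of points of the finite random configuration `u 0, …, u (n - 1)` lying in `B`. -/
def pointCount {Ω E : Type*} (n : Ω → ℕ) (u : ℕ → Ω → E) (B : Set E) (ω : Ω) : ℕ :=
  ((Finset.range (n ω)).filter (fun i => u i ω ∈ B)).card

/-- The random points `u 0, …, u (n - 1)` (a random number `n` of them) form a Poisson point
process with finite intensity measure `Λ`: the number of points in a measurable set `B` is
Poisson distributed with mean `Λ B`, and the numbers of points in disjoint sets are independent. -/
structure IsPoissonProcess {Ω E : Type*} [MeasurableSpace Ω] [MeasurableSpace E]
    (P : Measure Ω) (Λ : Measure E) (n : Ω → ℕ) (u : ℕ → Ω → E) : Prop where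
  finite_intensity : Λ Set.univ < ∞
  measurable_count : Measurable n
  measurable_point : ∀ i, Measurable (u i)
  poisson_law : ∀ B : Set E, MeasurableSet B →
    P.map (pointCount n u B) = poissonMeasure (Λ B).toNNReal
  indep_disjoint : ∀ (l : ℕ) (B : Fin l → Set E), (∀ i, MeasurableSet (B i)) →
    (∀ i j, i ≠ j → Disjoint (B i) (B j)) → iIndepFun (fun i => pointCount n u (B i)) P

/-! ### The deterministic part of the system -/

/-- Parameters of an uplink system with `K` tiers of satellites. -/
structure Uplink (K : ℕ) where
  /-- Earth radius -/
  RE : ℝ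
  /-- altitude of each tier -/
  alt : Fin K → ℝ
  /-- number of satellites of each tier -/
  num : Fin K → ℕ
  /-- the legitimate tier; satellites of all the other tiers are eavesdroppers -/
  legit : Fin K
  /-- half beamwidth angle of the satellites -/
  beam : ℝ
  /-- density of IoT devices per unit of area on the Earth's surface -/
  dens : ℝ
  /-- transmit power -/
  Pt : ℝ
  /-- product of the antenna gains -/
  G : ℝ
  /-- speed of light -/
  c : ℝ
  /-- carrier frequency -/
  f : ℝ
  /-- noise power -/
  noise : ℝ
  /-- information-bearing ratio: the fraction `1 - γ` of the power is artificial noise -/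
  γ : ℝ
  /-- shape of the Gamma fading -/
  m₁ : ℕ
  /-- scale of the Gamma fading -/
  m₂ : ℝ
  RE_pos : 0 < RE
  alt_pos : ∀ k, 0 < alt k
  beam_pos : 0 < beam
  dens_pos : 0 < dens
  Pt_pos : 0 < Pt
  G_pos : 0 < G
  c_pos : 0 < c
  f_pos : 0 < f
  noise_pos : 0 < noise
  γ_nonneg : 0 ≤ γ
  γ_le_one : γ ≤ 1
  m₁_pos : 1 ≤ m₁
  m₂_pos : 0 < m₂

namespace Uplink

variable {K : ℕ} (S : Uplink K)

/-- Radius of the sphere carrying the satellites of tier `k`. -/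
def R (k : Fin K) : ℝ := S.alt k + S.RE

/-- The largest central angle at which a device is within the beam and the line of sight of a
satellite of tier `k`. -/
def thetaMax (k : Fin K) : ℝ :=
  if S.beam < Real.arcsin (S.RE / S.R k) then
    Real.arcsin (S.R k / S.RE * Real.sin S.beam) - S.beam
  else Real.arccos (S.RE / S.R k)

/-- Distance between a device and a satellite of tier `k` whose central angle is `θ`. -/
def distAt (k : Fin K) (θ : ℝ) : ℝ :=
  √(S.RE ^ 2 + S.R k ^ 2 - 2 * S.RE * S.R k * Real.cos θ)

/-- Power received over a link of length `d` whose small-scale fading power gain is `h`. -/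
def recPower (d h : ℝ) : ℝ :=
  S.Pt * (S.c / (4 * Real.pi * S.f * d)) ^ 2 * S.G * h

/-- The position `(0, 0, RE)` of the typical device. -/
def typical : E3 := !₂[0, 0, S.RE]

/-- The law of the Gamma fading, with shape `m₁` and scale `m₂`. -/
def gammaFading : Measure ℝ := gammaMeasure S.m₁ (1 / S.m₂)

/-- The approximation `[1 - exp(-(m₁!)^(-1/m₁) x / m₂)]^m₁` of the distribution function of the
Gamma fading. -/
def approxCDF (x : ℝ) : ℝ :=
  (1 - Real.exp (-(((S.m₁)! : ℝ) ^ (-(1 / (S.m₁ : ℝ))) / S.m₂ * x))) ^ S.m₁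

/-- The Laplace transform of the interference at a satellite of tier `k`, in integral form. -/
def laplaceInterference (k : Fin K) (s : ℝ) : ℝ :=
  Real.exp (-S.dens * ∫ _φ in (0 : ℝ)..(2 * Real.pi), ∫ θ in (0 : ℝ)..(S.thetaMax k),
    (1 - (1 + S.m₂ * s * S.Pt * S.G *
        (S.c / (4 * Real.pi * S.f * S.distAt k θ)) ^ 2) ^ (-(S.m₁ : ℤ))) *
      S.RE ^ 2 * Real.sin θ)

/-- The quantity `s_ES`, at central angle `θ`, for the threshold `β`. -/
def sES (β : ℝ) (k : Fin K) (θ : ℝ) : ℝ :=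
  ((S.m₁)! : ℝ) ^ (-(1 / (S.m₁ : ℝ))) / S.m₂ *
    (β / ((S.γ - β * (1 - S.γ)) * S.Pt * S.G)) *
    (4 * Real.pi * S.f * S.distAt k θ / S.c) ^ 2

/-- The contribution of one satellite of tier `k` to the secrecy outage formula. -/
def tierFactor (β : ℝ) (k : Fin K) : ℝ :=
  (∑ q ∈ Finset.range (S.m₁ + 1), ((S.m₁.choose q : ℕ) : ℝ) * (-1) ^ q *
    ∫ θ in (0 : ℝ)..(S.thetaMax k),
      Real.exp (-(q * S.sES β k θ * S.noise)) *
        S.laplaceInterference k (q * S.sES β k θ) * (Real.sin θ / 2)) +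
  (1 + Real.cos (S.thetaMax k)) / 2

/-- The closed form of the secrecy outage probability. -/
def outageFormula (β : ℝ) : ℝ :=
  ∏ k ∈ Finset.univ.erase S.legit, S.tierFactor β k ^ S.num k

/-- Labels of the eavesdroppers: pairs of a tier other than the legitimate one and a satellite of
that tier. -/
abbrev Eve : Type := (k : {k : Fin K // k ≠ S.legit}) × Fin (S.num k)

/-- The tier of an eavesdropper. -/
abbrev tier (e : S.Eve) : Fin K := e.1

end Uplink

/-! ### The random part of the system -/

/-- The random quantities seen by one eavesdropping satellite. The interfering devices are
`dev 0, …, dev (n - 1)`. -/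
structure EveData (Ω : Type*) where
  /-- position of the satellite -/
  pos : Ω → E3
  /-- fading power gain of the link from the typical device -/
  gain : Ω → ℝ
  /-- number of interfering devices -/
  n : Ω → ℕ
  /-- positions of the interfering devices -/
  dev : ℕ → Ω → E3
  /-- fading power gains of the links from the interfering devices -/
  devGain : ℕ → Ω → ℝ

namespace EveData

variable {Ω : Type*} {K : ℕ}

/-- All the random quantities of one eavesdropper, bundled in one random variable. -/
def all (D : EveData Ω) (ω : Ω) : E3 × ℝ × (ℕ × (ℕ → E3)) × (ℕ → ℝ) :=
  (D.pos ω, D.gain ω, (D.n ω, fun i => D.dev i ω), fun i => D.devGain i ω)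

open Classical in
/-- Interference power at an eavesdropper of tier `k`: the total power received from the interfering
devices within its coverage area. -/
def interference (S : Uplink K) (k : Fin K) (D : EveData Ω) (ω : Ω) : ℝ :=
  ∑ i ∈ Finset.range (D.n ω),
    if InnerProductGeometry.angle (D.pos ω) (D.dev i ω) < S.thetaMax k then
      S.recPower (dist (D.pos ω) (D.dev i ω)) (D.devGain i ω)
    else 0

open Classical in
/-- SINR of the eavesdropping link to a satellite of tier `k`; it is `0` when the typical device is
outside the coverage area of the satellite, which then receives no signal. -/
def sinr (S : Uplink K) (k : Fin K) (D : EveData Ω) (ω : Ω) : ℝ :=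
  if InnerProductGeometry.angle (D.pos ω) S.typical < S.thetaMax k then
    S.γ * S.recPower (dist (D.pos ω) S.typical) (D.gain ω) /
      ((1 - S.γ) * S.recPower (dist (D.pos ω) S.typical) (D.gain ω) +
        D.interference S k ω + S.noise)
  else 0

/-- The law of what a single eavesdropper of tier `k` sees, when the fading power gain of the link
from the typical device has law `ν`: the satellite is uniform on its sphere, the interfering devices
are a homogeneous Poisson process on the Earth's surface, their fading power gains are i.i.d. Gamma,
and all these quantities are mutually independent. Nothing is said about different eavesdroppers,
which may for instance see the same Poisson process of devices. -/
structure HasModelLaw [MeasurableSpace Ω] (D : EveData Ω) (S : Uplink K) (k : Fin K)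
    (ν : Measure ℝ) (P : Measure Ω) : Prop where
  measurable_pos : Measurable D.pos
  measurable_gain : Measurable D.gain
  measurable_devGain : ∀ i, Measurable (D.devGain i)
  pos_law : P.map D.pos = uniformSphere (S.R k)
  gain_law : P.map D.gain = ν
  devices : IsPoissonProcess P (ENNReal.ofReal S.dens • sphereArea S.RE) D.n D.dev
  devGain_law : ∀ i, P.map (D.devGain i) = S.gammaFading
  devGain_indep : iIndepFun D.devGain P
  indep_pos : IndepFun D.pos (fun ω => (D.all ω).2) P
  indep_gain : IndepFun D.gain (fun ω => (D.all ω).2.2) P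
  indep_devices : IndepFun (fun ω => (D.all ω).2.2.1) (fun ω => (D.all ω).2.2.2) P

end EveData

namespace Uplink

variable {Ω : Type*} {K : ℕ}

/-- The largest SINR over all eavesdroppers (`⊥` if there are none). -/
def maxSINR (S : Uplink K) (D : S.Eve → EveData Ω) (ω : Ω) : EReal :=
  Finset.univ.sup (fun e : S.Eve => (((D e).sinr S (S.tier e) ω : ℝ) : EReal))

/-- The secrecy outage probability: the probability that the largest SINR over all eavesdroppers is
below the threshold `β`. -/
def outageProb [MeasurableSpace Ω] (S : Uplink K) (P : Measure Ω) (D : S.Eve → EveData Ω)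
    (β : ℝ) : ℝ :=
  P.real {ω | S.maxSINR D ω < (β : EReal)}

/-- The eavesdroppers are mutually independent: so are the families of all the random quantities
seen by each of them (positions, fading gains, interfering devices). -/
def EavesdroppersIndep [MeasurableSpace Ω] (S : Uplink K) (P : Measure Ω)
    (D : S.Eve → EveData Ω) : Prop :=
  iIndepFun (fun e => (D e).all) P

end Uplink

end

noncomputable section

/-! ### Zonal integration on spheres -/

/-! For one eavesdropper, clear the denominator in `SINR < β`. Since `β (1 - γ) < γ`, the inequality
says that the gain of the typical device is below a positive threshold that is affine in the
interference `I` (`sinrAt_lt_iff`). Position, gain and interferers are independent, so Fubini turns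
the outage probability into the mean of the gain's distribution function at this threshold, plus the
probability that the typical device is not covered (`prob_sinr_lt`).

When the distribution function is `(1 - exp(-a x)) ^ m₁`, the binomial theorem expands it into terms
`exp(-q s (I + σ²))`. Their means are values of the Laplace transform of `I`. By the probability
generating functional of a Poisson process and the Laplace transform of the Gamma law, that
transform is the exponential of an integral over the Earth's surface. The integrand depends only on
the central angle to the satellite, so Archimedes' hat-box theorem (`map_angle_sphereArea`) reduces
it to an integral in `θ`, the same for every position of the satellite. Hat-box applied to the
satellite itself gives the weight `sin θ / 2`, and the uncovered region contributes `(1 + cos θmax)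
/ 2`.

For true Gamma gains, Alzer's inequality (`pow_one_sub_exp_le_cdf_gammaMeasure`) bounds the
distribution function below by the approximation, which integrates to the lower bound. For shape one
the law is exponential and both functions agree. Under independence the event that the maximum is
below `β` is an intersection of independent events, hence the products. -/

theorem lintegral_radial_plane {F : ℝ → ℝ≥0∞} (hF : Measurable F) :
    ∫⁻ q : ℝ × ℝ, F √(q.1 ^ 2 + q.2 ^ 2) =
      ∫⁻ ρ in Set.Ioi (0 : ℝ), ENNReal.ofReal (2 * Real.pi * ρ) * F ρ := by
  rw [← lintegral_comp_polarCoord_symm, polarCoord_target, Measure.volume_eq_prod,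
    ← Measure.prod_restrict]
  have h : ∀ᵐ p : ℝ × ℝ ∂((volume.restrict (Set.Ioi (0 : ℝ))).prod
      (volume.restrict (Set.Ioo (-Real.pi) Real.pi))), ENNReal.ofReal p.1 •
      F √((polarCoord.symm p).1 ^ 2 + (polarCoord.symm p).2 ^ 2) =
      ENNReal.ofReal p.1 * F p.1 := by
    rw [Measure.prod_restrict]
    filter_upwards [ae_restrict_mem (measurableSet_Ioi.prod measurableSet_Ioo)] with p hp
    have hp0 : 0 < p.1 := hp.1
    have : (polarCoord.symm p).1 ^ 2 + (polarCoord.symm p).2 ^ 2 = p.1 ^ 2 := by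
      rw [polarCoord_symm_apply]
      linear_combination p.1 ^ 2 * Real.sin_sq_add_cos_sq p.2
    rw [this, Real.sqrt_sq hp0.le, smul_eq_mul]
  rw [lintegral_congr_ae h, lintegral_prod _ (by fun_prop)]
  refine lintegral_congr fun ρ => ?_
  dsimp only
  rw [lintegral_const, Measure.restrict_apply_univ, Real.volume_Ioo,
    ENNReal.ofReal_mul (by positivity)]
  ring_nf

/-- The indicator keeps the right-hand side an integral over the whole plane, so that polar
coordinates can be applied to it a second time. -/
theorem lintegral_cylindrical {F : ℝ × ℝ → ℝ≥0∞} (hF : Measurable F) :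
    ∫⁻ y : E3, F (y 0, √(y 1 ^ 2 + y 2 ^ 2)) =
      ∫⁻ p : ℝ × ℝ, (Set.univ ×ˢ Set.Ioi (0 : ℝ)).indicator
        (fun p => ENNReal.ofReal (2 * Real.pi * p.2) * F p) p := by
  have e1 := (PiLp.volume_preserving_ofLp (Fin 3)).lintegral_comp_emb
    (MeasurableEquiv.toLp 2 (Fin 3 → ℝ)).symm.measurableEmbedding
    (fun y : Fin 3 → ℝ => F (y 0, √(y 1 ^ 2 + y 2 ^ 2)))
  have e2 := (volume_preserving_piFinSuccAbove (fun _ : Fin 3 => ℝ) 0).lintegral_comp_emb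
    (MeasurableEquiv.measurableEmbedding _)
    (fun q : ℝ × (Fin 2 → ℝ) => F (q.1, √(q.2 0 ^ 2 + q.2 1 ^ 2)))
  have e3 (z : ℝ) := (volume_preserving_finTwoArrow ℝ).lintegral_comp_emb
    (MeasurableEquiv.measurableEmbedding _)
    (fun q : ℝ × ℝ => F (z, √(q.1 ^ 2 + q.2 ^ 2)))
  refine e1.trans (Eq.trans ?_ (e2.trans ?_))
  · rfl
  · rw [Measure.volume_eq_prod, lintegral_prod _ (by fun_prop), Measure.volume_eq_prod,
      lintegral_prod]
    · refine lintegral_congr fun z => (e3 z).trans ?_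
      rw [lintegral_radial_plane (F := fun ρ => F (z, ρ)) (by fun_prop),
        ← lintegral_indicator measurableSet_Ioi]
      refine lintegral_congr fun ρ => ?_
      by_cases h : 0 < ρ <;> simp [Set.indicator, h]
    · exact (Measurable.indicator (by fun_prop)
        (MeasurableSet.univ.prod measurableSet_Ioi)).aemeasurable

/-- Spherical coordinates arise from two planar polar changes: one around the axis `e`, the other in
the half-plane of axial coordinate and distance to the axis. An orthonormal basis whose first vector
is `e / ‖e‖` makes the axial coordinate equal to `‖y‖ cos` of the angle. -/
theorem lintegral_zonal {F : ℝ → ℝ → ℝ≥0∞} (hF : Measurable (Function.uncurry F)) {e : E3}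
    (he : e ≠ 0) :
    ∫⁻ y : E3, F ‖y‖ (InnerProductGeometry.angle e y) =
      ∫⁻ r in Set.Ioi (0 : ℝ), ∫⁻ θ in Set.Ioo 0 Real.pi,
        ENNReal.ofReal (2 * Real.pi * r ^ 2 * Real.sin θ) * F r θ := by
  obtain ⟨b, hb⟩ : ∃ b : OrthonormalBasis (Fin 3) ℝ E3, b 0 = ‖e‖⁻¹ • e := by
    have hv : Orthonormal ℝ (({0} : Set (Fin 3)).domRestrict (fun _ : Fin 3 => ‖e‖⁻¹ • e)) := by
      rw [orthonormal_iff_ite]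
      rintro ⟨i, rfl⟩ ⟨j, rfl⟩
      change inner ℝ (‖e‖⁻¹ • e) (‖e‖⁻¹ • e) = _
      simp [norm_smul, he]
    obtain ⟨b, hb⟩ := hv.exists_orthonormalBasis_extension_of_card_eq (by simp)
    exact ⟨b, hb 0 rfl⟩
  have hr (y : E3) : F ‖y‖ (InnerProductGeometry.angle e y) =
      (fun p : ℝ × ℝ => F √(p.1 ^ 2 + p.2 ^ 2) (Real.arccos (p.1 / √(p.1 ^ 2 + p.2 ^ 2))))
        ((b.repr y) 0, √((b.repr y) 1 ^ 2 + (b.repr y) 2 ^ 2)) := by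
    have h1 : ‖y‖ = √((b.repr y) 0 ^ 2 + √((b.repr y) 1 ^ 2 + (b.repr y) 2 ^ 2) ^ 2) := by
      rw [← b.repr.norm_map y, EuclideanSpace.norm_eq, Real.sq_sqrt (by positivity)]
      simp [Fin.sum_univ_three, add_assoc]
    have h2 : (b.repr y) 0 = ‖e‖⁻¹ * inner ℝ e y := by
      rw [b.repr_apply_apply, hb, real_inner_smul_left]
    dsimp only
    rw [← h1, h2, InnerProductGeometry.angle, inv_mul_eq_div, div_div]
  have e1 := b.measurePreserving_repr.lintegral_comp_emb
    b.repr.toHomeomorph.measurableEmbedding (fun y : E3 =>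
      (fun p : ℝ × ℝ => F √(p.1 ^ 2 + p.2 ^ 2) (Real.arccos (p.1 / √(p.1 ^ 2 + p.2 ^ 2))))
        (y 0, √(y 1 ^ 2 + y 2 ^ 2)))
  have hm : Measurable fun p : ℝ × ℝ =>
      F √(p.1 ^ 2 + p.2 ^ 2) (Real.arccos (p.1 / √(p.1 ^ 2 + p.2 ^ 2))) :=
    hF.comp (.prodMk (by fun_prop) (Real.measurable_arccos.comp (by fun_prop)))
  rw [lintegral_congr hr, e1, lintegral_cylindrical hm, ← lintegral_comp_polarCoord_symm,
    polarCoord_target]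
  have hc : ∀ p ∈ Set.Ioi (0 : ℝ) ×ˢ Set.Ioo (-Real.pi) Real.pi,
      ENNReal.ofReal p.1 • (Set.univ ×ˢ Set.Ioi (0 : ℝ)).indicator
        (fun p : ℝ × ℝ => ENNReal.ofReal (2 * Real.pi * p.2) *
          F √(p.1 ^ 2 + p.2 ^ 2) (Real.arccos (p.1 / √(p.1 ^ 2 + p.2 ^ 2)))) (polarCoord.symm p) =
      (Set.univ ×ˢ Set.Ioo 0 Real.pi).indicator (fun p : ℝ × ℝ =>
        ENNReal.ofReal (2 * Real.pi * p.1 ^ 2 * Real.sin p.2) * F p.1 p.2) p := by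
    rintro ⟨r, θ⟩ ⟨hr0 : 0 < r, hθ⟩
    have hsq : (r * Real.cos θ) ^ 2 + (r * Real.sin θ) ^ 2 = r ^ 2 := by
      linear_combination r ^ 2 * Real.sin_sq_add_cos_sq θ
    rw [polarCoord_symm_apply]
    by_cases h : 0 < θ
    · have hs : 0 < Real.sin θ := Real.sin_pos_of_pos_of_lt_pi h hθ.2
      rw [Set.indicator_of_mem (by simp [hr0, hs]), Set.indicator_of_mem (by simp [h, hθ.2])]
      dsimp only
      rw [hsq, Real.sqrt_sq hr0.le, mul_div_cancel_left₀ _ hr0.ne', Real.arccos_cos h.le hθ.2.le,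
        smul_eq_mul, ← mul_assoc, ← ENNReal.ofReal_mul hr0.le]
      ring_nf
    · have hs : Real.sin θ ≤ 0 := Real.sin_nonpos_of_nonpos_of_neg_pi_le (not_lt.1 h) hθ.1.le
      rw [Set.indicator_of_notMem (by simp [hr0, hs]), Set.indicator_of_notMem (by simp [h])]
      simp
  rw [setLIntegral_congr_fun (measurableSet_Ioi.prod measurableSet_Ioo) hc,
    lintegral_indicator (MeasurableSet.univ.prod measurableSet_Ioo),
    Measure.restrict_restrict (MeasurableSet.univ.prod measurableSet_Ioo), Set.prod_inter_prod,
    Set.univ_inter, Set.inter_eq_left.2 (Set.Ioo_subset_Ioo_left (by linarith [Real.pi_pos])),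
    Measure.volume_eq_prod, ← Measure.prod_restrict, lintegral_prod]
  refine Measurable.aemeasurable (Measurable.mul (by fun_prop) hF)

theorem measurable_angle {e : E3} : Measurable fun y : E3 => InnerProductGeometry.angle e y :=
  Real.measurable_arccos.comp (by fun_prop)

open scoped Pointwise in
/-- Archimedes' hat-box theorem: the distribution, under the surface area of a sphere, of the
central angle with a fixed direction. -/
theorem map_angle_sphereArea {e : E3} (he : e ≠ 0) {R : ℝ} (hR : 0 < R) :
    (sphereArea R).map (fun y => InnerProductGeometry.angle e y) =
      (volume.restrict (Set.Ioo 0 Real.pi)).withDensity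
        (fun θ => ENNReal.ofReal (2 * Real.pi * R ^ 2 * Real.sin θ)) := by
  have hsm : Measurable fun z : Metric.sphere (0 : E3) 1 => R • (z : E3) := by fun_prop
  ext A hA
  have hT : MeasurableSet {z : Metric.sphere (0 : E3) 1 |
      InnerProductGeometry.angle e (z : E3) ∈ A} :=
    (measurable_angle.comp measurable_subtype_coe) hA
  have hpre : (fun z : Metric.sphere (0 : E3) 1 => R • (z : E3)) ⁻¹'
      ((fun y => InnerProductGeometry.angle e y) ⁻¹' A) =
      {z : Metric.sphere (0 : E3) 1 | InnerProductGeometry.angle e (z : E3) ∈ A} := by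
    ext z
    simp [InnerProductGeometry.angle_smul_right_of_pos _ _ hR]
  -- `toSphere` measures a set by the dimension times the volume of the cone over it. This
  -- identifies the cone, whose volume is then computed by zonal integration.
  have hcone : Set.Ioo (0 : ℝ) 1 • (Subtype.val '' {z : Metric.sphere (0 : E3) 1 |
      InnerProductGeometry.angle e (z : E3) ∈ A}) =
      {y : E3 | ‖y‖ ∈ Set.Ioo (0 : ℝ) 1 ∧ InnerProductGeometry.angle e y ∈ A} := by
    ext y
    simp only [Set.mem_smul, Set.mem_image, Set.mem_ofPred_eq]
    constructor
    · rintro ⟨r, hr, _, ⟨z, hz, rfl⟩, rfl⟩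
      rw [InnerProductGeometry.angle_smul_right_of_pos _ _ hr.1, norm_smul,
        norm_eq_of_mem_sphere, mul_one, Real.norm_of_nonneg hr.1.le]
      exact ⟨hr, hz⟩
    · rintro ⟨hy, hyA⟩
      refine ⟨‖y‖, hy, ‖y‖⁻¹ • y, ⟨⟨‖y‖⁻¹ • y, ?_⟩, ?_, rfl⟩, smul_inv_smul₀ hy.1.ne' y⟩
      · simp [norm_smul, hy.1.ne']
      · rwa [InnerProductGeometry.angle_smul_right_of_pos _ _ (inv_pos.2 hy.1)]
  have hvol : volume {y : E3 | ‖y‖ ∈ Set.Ioo (0 : ℝ) 1 ∧ InnerProductGeometry.angle e y ∈ A} =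
      ∫⁻ r in Set.Ioo (0 : ℝ) 1, ENNReal.ofReal (r ^ 2) *
        ∫⁻ θ in Set.Ioo 0 Real.pi, A.indicator
          (fun θ => ENNReal.ofReal (2 * Real.pi * Real.sin θ)) θ := by
    have hms : MeasurableSet {y : E3 | ‖y‖ ∈ Set.Ioo (0 : ℝ) 1 ∧
        InnerProductGeometry.angle e y ∈ A} :=
      (measurable_norm measurableSet_Ioo).inter (measurable_angle hA)
    have hz := lintegral_zonal (F := fun r θ => (Set.Ioo (0 : ℝ) 1 ×ˢ A).indicator 1 (r, θ))
      (Measurable.indicator measurable_one (measurableSet_Ioo.prod hA)) he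
    rw [← lintegral_indicator_one hms]
    refine Eq.trans (lintegral_congr fun y => ?_) (hz.trans ?_)
    · rfl
    · rw [← lintegral_indicator measurableSet_Ioi, ← lintegral_indicator measurableSet_Ioo]
      refine lintegral_congr fun r => ?_
      by_cases h : r ∈ Set.Ioo (0 : ℝ) 1
      · rw [Set.indicator_of_mem (show r ∈ Set.Ioi (0 : ℝ) from h.1), Set.indicator_of_mem h,
          ← lintegral_const_mul _ (by exact Measurable.indicator (by fun_prop) hA)]
        refine lintegral_congr fun θ => ?_
        by_cases hθ : θ ∈ A
        · rw [Set.indicator_of_mem (by exact ⟨h, hθ⟩), Set.indicator_of_mem hθ, Pi.one_apply,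
            mul_one, ← ENNReal.ofReal_mul (by positivity)]
          ring_nf
        · rw [Set.indicator_of_notMem (by simp [hθ]), Set.indicator_of_notMem hθ]
          simp
      · rw [Set.indicator_of_notMem h]
        by_cases h0 : r ∈ Set.Ioi (0 : ℝ)
        · rw [Set.indicator_of_mem h0]
          simp [Set.indicator, h]
        · rw [Set.indicator_of_notMem h0]
  have hcube : ∫⁻ r in Set.Ioo (0 : ℝ) 1, ENNReal.ofReal (r ^ 2) = ENNReal.ofReal (1 / 3) := by
    rw [← ofReal_integral_eq_lintegral_ofReal, ← integral_Ioc_eq_integral_Ioo,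
      ← intervalIntegral.integral_of_le zero_le_one, integral_pow]
    · norm_num
    · exact ((continuous_pow 2).integrableOn_Icc (a := 0) (b := 1)).mono_set Set.Ioo_subset_Icc_self
    · exact ae_of_all _ fun r => sq_nonneg r
  rw [Measure.map_apply measurable_angle hA, sphereArea, Measure.smul_apply,
    Measure.map_apply hsm (measurable_angle hA), hpre, Measure.toSphere_apply' _ hT, hcone, hvol,
    lintegral_mul_const _ (by fun_prop), hcube, withDensity_apply _ hA,
    Measure.restrict_restrict hA, lintegral_indicator hA, Measure.restrict_restrict hA]
  -- The dimension factor 3 cancels the radial integral of `r ^ 2` over `(0, 1)`.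
  have h3 : ((Module.finrank ℝ E3 : ℕ) : ℝ≥0∞) * ENNReal.ofReal (1 / 3) = 1 := by
    rw [finrank_euclideanSpace_fin, ← ENNReal.ofReal_natCast, ← ENNReal.ofReal_mul (by positivity)]
    norm_num
  rw [← mul_assoc, h3, one_mul, smul_eq_mul, ← lintegral_const_mul _ (by fun_prop)]
  refine lintegral_congr fun θ => ?_
  rw [← ENNReal.ofReal_mul (by positivity)]
  ring_nf

theorem ae_norm_sphereArea {R : ℝ} (hR : 0 ≤ R) : ∀ᵐ y ∂sphereArea R, ‖y‖ = R := by
  refine Measure.ae_smul_measure ?_ _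
  rw [ae_map_iff (by fun_prop) (measurableSet_eq_fun (by fun_prop) (by fun_prop))]
  refine ae_of_all _ fun z => ?_
  rw [norm_smul, norm_eq_of_mem_sphere, mul_one, Real.norm_of_nonneg hR]

instance isFiniteMeasure_sphereArea (R : ℝ) : IsFiniteMeasure (sphereArea R) := by
  have : IsFiniteMeasure (ENNReal.ofReal (R ^ 2) •
      ((volume : Measure E3).toSphere.map (fun z : Metric.sphere (0 : E3) 1 => R • (z : E3)))) :=
    Measure.smul_finite _ ENNReal.ofReal_ne_top
  exact this

theorem integral_comp_angle_sphereArea {e : E3} (he : e ≠ 0) {R : ℝ} (hR : 0 < R) {g : ℝ → ℝ}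
    (hg : Measurable g) :
    ∫ y, g (InnerProductGeometry.angle e y) ∂sphereArea R =
      2 * Real.pi * R ^ 2 * ∫ θ in (0 : ℝ)..Real.pi, g θ * Real.sin θ := by
  rw [← integral_map (measurable_angle (e := e)).aemeasurable
    hg.aestronglyMeasurable, map_angle_sphereArea he hR,
    integral_withDensity_eq_integral_toReal_smul (by fun_prop)
      (ae_of_all _ fun _ => ENNReal.ofReal_lt_top),
    intervalIntegral.integral_of_le Real.pi_pos.le, integral_Ioc_eq_integral_Ioo,
    ← integral_const_mul]
  refine setIntegral_congr_fun measurableSet_Ioo fun θ hθ => ?_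
  have : 0 < Real.sin θ := Real.sin_pos_of_mem_Ioo hθ
  rw [ENNReal.toReal_ofReal (by positivity), smul_eq_mul]
  ring

theorem sphereArea_real_univ {R : ℝ} (hR : 0 < R) :
    (sphereArea R).real Set.univ = 4 * Real.pi * R ^ 2 := by
  have h := integral_comp_angle_sphereArea (e := EuclideanSpace.single 0 1)
    (by simp) hR (g := fun _ => 1) measurable_const
  simp only [integral_const, smul_eq_mul, mul_one, one_mul, integral_sin, Real.cos_zero,
    Real.cos_pi] at h
  rw [h]
  ring

theorem integral_comp_angle_uniformSphere {e : E3} (he : e ≠ 0) {R : ℝ} (hR : 0 < R) {g : ℝ → ℝ}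
    (hg : Measurable g) :
    ∫ y, g (InnerProductGeometry.angle e y) ∂uniformSphere R =
      ∫ θ in (0 : ℝ)..Real.pi, g θ * (Real.sin θ / 2) := by
  rw [uniformSphere, integral_smul_measure, integral_comp_angle_sphereArea he hR hg,
    ENNReal.toReal_inv, ← measureReal_def, sphereArea_real_univ hR, smul_eq_mul, ← mul_assoc,
    ← intervalIntegral.integral_const_mul]
  refine intervalIntegral.integral_congr fun θ _ => ?_
  have := Real.pi_pos
  field_simp
  norm_num

/-! ### Laplace functionals of marked Poisson processes -/

theorem measurable_sum_range_count {α : Type*} [MeasurableSpace α] {n : α → ℕ} (hn : Measurable n)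
    {f : ℕ → α → ℝ} (hf : ∀ i, Measurable (f i)) :
    Measurable fun a => ∑ i ∈ Finset.range (n a), f i a := by
  have : Measurable fun p : ℕ × α => ∑ i ∈ Finset.range p.1, f i p.2 :=
    measurable_from_prod_countable_right fun k =>
      Finset.measurable_fun_sum (Finset.range k) fun i _ => hf i
  exact this.comp (hn.prodMk measurable_id)

theorem measurable_prod_range_count {α : Type*} [MeasurableSpace α] {n : α → ℕ} (hn : Measurable n)
    {f : ℕ → α → ℝ} (hf : ∀ i, Measurable (f i)) :
    Measurable fun a => ∏ i ∈ Finset.range (n a), f i a := by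
  have : Measurable fun p : ℕ × α => ∏ i ∈ Finset.range p.1, f i p.2 :=
    measurable_from_prod_countable_right fun k =>
      Finset.measurable_fun_prod (Finset.range k) fun i _ => hf i
  exact this.comp (hn.prodMk measurable_id)

theorem integral_pow_poissonMeasure (r : ℝ≥0) (c : ℝ) :
    ∫ n, c ^ n ∂poissonMeasure r = Real.exp (-(r * (1 - c))) := by
  have h : HasSum (fun n : ℕ => (Real.exp (-r) * r ^ n / n !) • c ^ n)
      (Real.exp (-r) * Real.exp (r * c)) := by
    have := (NormedSpace.expSeries_div_hasSum_exp ((r : ℝ) * c)).mul_left (Real.exp (-r))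
    rw [← Real.exp_eq_exp_ℝ] at this
    refine this.congr_fun fun n => ?_
    rw [smul_eq_mul, mul_pow]
    ring
  rw [integral_poissonMeasure, h.tsum_eq, ← Real.exp_add]
  ring_nf

section PoissonProcess

variable {Ω E : Type*} [MeasurableSpace Ω] [MeasurableSpace E] {P : Measure Ω} {Λ : Measure E}
  {n : Ω → ℕ} {u : ℕ → Ω → E}

/-- Grouping the points by the value of `g` brings in only counts in disjoint sets, which is all
that the definition of a Poisson process speaks about. -/
theorem prod_comp_eq_prod_pow_pointCount {Ω E : Type*} [MeasurableSpace E]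
    {n : Ω → ℕ} {u : ℕ → Ω → E} (g : SimpleFunc E ℝ) {l : ℕ} (e : Fin l ≃ g.range)
    (ω : Ω) : ∏ i ∈ Finset.range (n ω), g (u i ω) =
      ∏ j, (e j : ℝ) ^ pointCount n u (g ⁻¹' {(e j : ℝ)}) ω := by
  classical
  have h (x : E) : g x = ∏ j, if x ∈ g ⁻¹' {(e j : ℝ)} then (e j : ℝ) else 1 := by
    rw [Finset.prod_eq_single (e.symm ⟨g x, g.mem_range_self x⟩)]
    · simp
    · intro j _ hj
      rw [if_neg]
      rintro (hx : g x = e j)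
      exact hj (by simp [hx])
    · simp
  rw [Finset.prod_congr rfl fun i _ => h (u i ω), Finset.prod_comm]
  refine Finset.prod_congr rfl fun j _ => ?_
  rw [Finset.prod_ite, Finset.prod_const, Finset.prod_const_one, mul_one, pointCount]

theorem integral_one_sub_simpleFunc [IsFiniteMeasure Λ] (g : SimpleFunc E ℝ) {l : ℕ}
    (e : Fin l ≃ g.range) :
    ∫ x, (1 - g x) ∂Λ = ∑ j, Λ.real (g ⁻¹' {(e j : ℝ)}) * (1 - (e j : ℝ)) := by
  have h (x : E) : 1 - g x =
      ∑ j, (g ⁻¹' {(e j : ℝ)}).indicator (fun _ => 1 - (e j : ℝ)) x := by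
    rw [Finset.sum_eq_single (e.symm ⟨g x, g.mem_range_self x⟩)]
    · simp
    · intro j _ hj
      rw [Set.indicator_of_notMem]
      rintro (hx : g x = e j)
      exact hj (by simp [hx])
    · simp
  rw [integral_congr_ae (ae_of_all _ h), integral_finsetSum]
  · refine Finset.sum_congr rfl fun j _ => ?_
    rw [integral_indicator_const _ (g.measurableSet_fiber _), smul_eq_mul]
  · exact fun j _ => (integrable_const _).indicator (g.measurableSet_fiber _)

namespace IsPoissonProcess

/-- The fibre counts are independent Poisson variables, so the mean factors. A fibre `B` with value
`c` contributes `exp(-Λ(B) (1 - c))`. -/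
theorem integral_prod_simpleFunc [IsProbabilityMeasure P] (h : IsPoissonProcess P Λ n u)
    (g : SimpleFunc E ℝ) :
    ∫ ω, ∏ i ∈ Finset.range (n ω), g (u i ω) ∂P = Real.exp (-∫ x, (1 - g x) ∂Λ) := by
  have : IsFiniteMeasure Λ := ⟨h.finite_intensity⟩
  let e : Fin g.range.card ≃ g.range := g.range.equivFin.symm
  have hm (j) : MeasurableSet (g ⁻¹' {(e j : ℝ)}) := g.measurableSet_fiber _
  have hae (j) : AEMeasurable (pointCount n u (g ⁻¹' {(e j : ℝ)})) P := by
    -- The pushforward along a map that is not a.e. measurable is zero by convention, so a law that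
    -- is a probability measure gives measurability.
    refine AEMeasurable.of_map_ne_zero ?_
    rw [h.poisson_law _ (hm j)]
    exact IsProbabilityMeasure.ne_zero _
  have hind : iIndepFun (fun j => pointCount n u (g ⁻¹' {(e j : ℝ)})) P := by
    refine h.indep_disjoint _ _ hm fun i j hij => ?_
    refine (Set.disjoint_singleton.2 fun hc => hij ?_).preimage _
    exact e.injective (Subtype.ext hc)
  have hind' := hind.comp (fun j k => (e j : ℝ) ^ k) fun j => measurable_of_countable _
  simp_rw [prod_comp_eq_prod_pow_pointCount g e]
  refine (hind'.integral_fun_prod_eq_prod_integral fun j =>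
    ((measurable_of_countable _).comp_aemeasurable (hae j)).aestronglyMeasurable).trans ?_
  rw [integral_one_sub_simpleFunc g e, ← Finset.sum_neg_distrib, Real.exp_sum]
  refine Finset.prod_congr rfl fun j _ => ?_
  have := integral_map (hae j) (f := fun k : ℕ => (e j : ℝ) ^ k)
    (measurable_of_countable _).aestronglyMeasurable
  rw [h.poisson_law _ (hm j), integral_pow_poissonMeasure] at this
  exact this.symm

/-- The probability generating functional of a Poisson process. -/
theorem integral_prod_comp [IsProbabilityMeasure P] (h : IsPoissonProcess P Λ n u) {g : E → ℝ}
    (hg : Measurable g) (h01 : ∀ x, g x ∈ Set.Icc (0 : ℝ) 1) :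
    ∫ ω, ∏ i ∈ Finset.range (n ω), g (u i ω) ∂P = Real.exp (-∫ x, (1 - g x) ∂Λ) := by
  have : IsFiniteMeasure Λ := ⟨h.finite_intensity⟩
  -- Approximating within `[0, 1]` bounds all the products by 1, which allows dominated convergence
  -- on both sides.
  let G (k : ℕ) : SimpleFunc E ℝ :=
    SimpleFunc.approxOn g hg (Set.Icc (0 : ℝ) 1) 0 (by simp) k
  have hG (k : ℕ) (x : E) : G k x ∈ Set.Icc (0 : ℝ) 1 := SimpleFunc.approxOn_mem _ _ _ _
  have hlim (x : E) : Filter.Tendsto (fun k => G k x) Filter.atTop (nhds (g x)) :=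
    SimpleFunc.tendsto_approxOn _ _ (subset_closure (h01 x))
  have h1 : Filter.Tendsto (fun k => ∫ ω, ∏ i ∈ Finset.range (n ω), G k (u i ω) ∂P) Filter.atTop
      (nhds (∫ ω, ∏ i ∈ Finset.range (n ω), g (u i ω) ∂P)) := by
    refine tendsto_integral_of_dominated_convergence (fun _ => 1) (fun k => ?_)
      (integrable_const _) (fun k => ae_of_all _ fun ω => ?_) (ae_of_all _ fun ω => ?_)
    · exact (measurable_prod_range_count h.measurable_count fun i =>
        (G k).measurable.comp (h.measurable_point i)).aestronglyMeasurable
    · rw [Real.norm_of_nonneg (Finset.prod_nonneg fun i _ => (hG k _).1)]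
      exact Finset.prod_le_one (fun i _ => (hG k _).1) fun i _ => (hG k _).2
    · exact tendsto_finsetProd _ fun i _ => hlim _
  have h2 : Filter.Tendsto (fun k => ∫ x, (1 - G k x) ∂Λ) Filter.atTop
      (nhds (∫ x, (1 - g x) ∂Λ)) := by
    refine tendsto_integral_of_dominated_convergence (fun _ => 1) (fun k => ?_)
      (integrable_const _) (fun k => ae_of_all _ fun x => ?_) (ae_of_all _ fun x => ?_)
    · exact (measurable_const.sub (G k).measurable).aestronglyMeasurable
    · rw [Real.norm_of_nonneg (sub_nonneg.2 (hG k x).2)]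
      linarith [(hG k x).1]
    · exact (hlim x).const_sub 1
  refine tendsto_nhds_unique h1 ?_
  simp_rw [h.integral_prod_simpleFunc]
  exact (Real.continuous_exp.tendsto _).comp h2.neg

end IsPoissonProcess

end PoissonProcess

/-! ### Laplace transforms with Gamma marks -/

theorem gammaMeasure_Iio_zero (a r : ℝ) : gammaMeasure a r (Set.Iio 0) = 0 := by
  rw [gammaMeasure, withDensity_apply _ measurableSet_Iio, lintegral_gammaPDF_of_nonpos le_rfl]

theorem integral_exp_neg_mul_gammaMeasure {m : ℕ} (hm : 1 ≤ m) {b : ℝ} (hb : 0 < b) {t : ℝ}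
    (ht : 0 ≤ t) :
    ∫ x, Real.exp (-(t * x)) ∂gammaMeasure m (1 / b) = (1 + b * t) ^ (-(m : ℤ)) := by
  have hm0 : (0 : ℝ) < m := by exact_mod_cast hm
  have hr : 0 < 1 / b := by positivity
  have hG := Real.Gamma_pos_of_pos hm0
  have hpdf : ∀ x ∈ Set.Ioi (0 : ℝ), (gammaPDF m (1 / b) x).toReal • Real.exp (-(t * x)) =
      (1 / b) ^ (m : ℝ) / Real.Gamma m * (x ^ ((m : ℝ) - 1) * Real.exp (-((1 / b + t) * x))) := by
    intro x hx
    have hx0 : (0 : ℝ) < x := hx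
    rw [gammaPDF_of_nonneg hx0.le, ENNReal.toReal_ofReal (by positivity), smul_eq_mul, add_mul,
      neg_add, Real.exp_add]
    ring
  rw [gammaMeasure, integral_withDensity_eq_integral_toReal_smul
    (f := gammaPDF m (1 / b)) (measurable_gammaPDFReal _ _).ennreal_ofReal
    (ae_of_all _ fun _ => ENNReal.ofReal_lt_top),
    ← setIntegral_eq_integral_of_forall_compl_eq_zero (s := Set.Ici 0),
    integral_Ici_eq_integral_Ioi, setIntegral_congr_fun measurableSet_Ioi hpdf, integral_const_mul,
    Real.integral_rpow_mul_exp_neg_mul_Ioi hm0 (by positivity), Real.rpow_natCast,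
    Real.rpow_natCast, zpow_neg, zpow_natCast]
  · have h1 : 1 / b + t = (1 + b * t) / b := by field_simp
    have h2 : 0 < 1 + b * t := by positivity
    rw [h1]
    field_simp
    rw [← mul_pow, ← mul_pow, show 1 / b * (b / (1 + b * t)) * (1 + b * t) = 1 by field_simp,
      one_pow]
  · intro x hx
    rw [gammaPDF_of_neg (by simpa using hx)]
    simp

theorem integral_exp_neg_sum_gamma {Ω : Type*} [MeasurableSpace Ω] {P : Measure Ω}
    {m : ℕ} (hm : 1 ≤ m) {b : ℝ} (hb : 0 < b) {h : ℕ → Ω → ℝ} (hh : ∀ i, Measurable (h i))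
    (hlaw : ∀ i, P.map (h i) = gammaMeasure m (1 / b)) (hind : iIndepFun h P) {t : ℕ → ℝ}
    (ht : ∀ i, 0 ≤ t i) (N : ℕ) :
    ∫ ω, Real.exp (-∑ i ∈ Finset.range N, t i * h i ω) ∂P =
      ∏ i ∈ Finset.range N, (1 + b * t i) ^ (-(m : ℤ)) := by
  have hind' := (hind.precomp (g := fun i : Fin N => (i : ℕ)) Fin.val_injective).comp
    (fun i x => Real.exp (-(t i * x))) fun i => by fun_prop
  simp_rw [← Finset.sum_neg_distrib, Real.exp_sum, Finset.prod_range]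
  refine (hind'.integral_fun_prod_eq_prod_integral fun i => ?_).trans ?_
  · exact (Measurable.comp (by fun_prop) (hh i)).aestronglyMeasurable
  · refine Finset.prod_congr rfl fun i _ => ?_
    rw [← integral_exp_neg_mul_gammaMeasure hm hb (ht i), ← hlaw i,
      integral_map (hh i).aemeasurable (Measurable.aestronglyMeasurable (by fun_prop))]
    rfl

/-- The Laplace functional of a Poisson process with independent Gamma marks. -/
theorem IsPoissonProcess.integral_exp_neg_sum_gamma {Ω E : Type*} [MeasurableSpace Ω]
    [MeasurableSpace E] {P : Measure Ω} [IsProbabilityMeasure P] {Λ : Measure E} {n : Ω → ℕ}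
    {u : ℕ → Ω → E} (hp : IsPoissonProcess P Λ n u) {m : ℕ} (hm : 1 ≤ m) {b : ℝ} (hb : 0 < b)
    {h : ℕ → Ω → ℝ} (hh : ∀ i, Measurable (h i))
    (hlaw : ∀ i, P.map (h i) = gammaMeasure m (1 / b)) (hind : iIndepFun h P)
    (hindep : IndepFun (fun ω => (n ω, fun i => u i ω)) (fun ω i => h i ω) P)
    {f : E → ℝ} (hf : Measurable f) (hf0 : ∀ x, 0 ≤ f x) :
    ∫ ω, Real.exp (-∑ i ∈ Finset.range (n ω), f (u i ω) * h i ω) ∂P =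
      Real.exp (-∫ x, (1 - (1 + b * f x) ^ (-(m : ℤ))) ∂Λ) := by
  have hX : Measurable fun ω => (n ω, fun i => u i ω) :=
    hp.measurable_count.prodMk (measurable_pi_lambda _ hp.measurable_point)
  have hY : Measurable fun ω i => h i ω := measurable_pi_lambda _ hh
  -- The joint law of points and marks is a product. Integrating the marks with the points fixed
  -- leaves a product over the points, to which the generating functional applies.
  have hXY := (indepFun_iff_map_prod_eq_prod_map_map hX.aemeasurable hY.aemeasurable).1 hindep
  have hg01 (x : E) : (1 + b * f x) ^ (-(m : ℤ)) ∈ Set.Icc (0 : ℝ) 1 := by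
    have h1 : 1 ≤ 1 + b * f x := le_add_of_nonneg_right (mul_nonneg hb.le (hf0 x))
    rw [zpow_neg, zpow_natCast]
    exact ⟨by positivity, inv_le_one_of_one_le₀ (one_le_pow₀ h1)⟩
  rw [← hp.integral_prod_comp (by simp_rw [zpow_neg, zpow_natCast]; fun_prop) hg01]
  have hS : Measurable fun z : (ℕ × (ℕ → E)) × (ℕ → ℝ) =>
      ∑ i ∈ Finset.range z.1.1, f (z.1.2 i) * z.2 i :=
    measurable_sum_range_count (by fun_prop) fun i => by fun_prop
  have hE : Measurable fun z : (ℕ × (ℕ → E)) × (ℕ → ℝ) =>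
      Real.exp (-∑ i ∈ Finset.range z.1.1, f (z.1.2 i) * z.2 i) := hS.neg.exp
  -- The marks are nonnegative only almost surely. This bounds the exponential by 1 and gives the
  -- integrability needed for Fubini.
  have hpos : ∀ᵐ ω ∂P, ∀ i, 0 ≤ h i ω := by
    refine ae_all_iff.2 fun i => ?_
    have : ∀ᵐ x ∂P.map (h i), 0 ≤ x := by
      rw [hlaw i, ae_iff]
      simp only [not_le]
      exact gammaMeasure_Iio_zero m (1 / b)
    exact ae_of_ae_map (hh i).aemeasurable this
  have hint : Integrable (fun z : (ℕ × (ℕ → E)) × (ℕ → ℝ) =>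
      Real.exp (-∑ i ∈ Finset.range z.1.1, f (z.1.2 i) * z.2 i))
      ((P.map fun ω => (n ω, fun i => u i ω)).prod (P.map fun ω i => h i ω)) := by
    rw [← hXY, integrable_map_measure hE.aestronglyMeasurable
      (hX.prodMk hY).aemeasurable]
    refine Integrable.of_bound
      (hE.comp (hX.prodMk hY)).aestronglyMeasurable 1 ?_
    filter_upwards [hpos] with ω hω
    rw [Function.comp_apply, Real.norm_of_nonneg (Real.exp_pos _).le, Real.exp_le_one_iff,
      neg_nonpos]
    exact Finset.sum_nonneg fun i _ => mul_nonneg (hf0 _) (hω i)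
  calc
    _ = ∫ z, Real.exp (-∑ i ∈ Finset.range z.1.1, f (z.1.2 i) * z.2 i)
          ∂((P.map fun ω => (n ω, fun i => u i ω)).prod (P.map fun ω i => h i ω)) := by
      rw [← hXY, integral_map (hX.prodMk hY).aemeasurable hE.aestronglyMeasurable]
    _ = ∫ x, ∫ y, Real.exp (-∑ i ∈ Finset.range x.1, f (x.2 i) * y i)
          ∂(P.map fun ω i => h i ω) ∂(P.map fun ω => (n ω, fun i => u i ω)) :=
      integral_prod _ hint
    _ = ∫ x, ∏ i ∈ Finset.range x.1, (1 + b * f (x.2 i)) ^ (-(m : ℤ))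
          ∂(P.map fun ω => (n ω, fun i => u i ω)) := by
      refine integral_congr_ae (ae_of_all _ fun x => ?_)
      dsimp only
      rw [integral_map hY.aemeasurable]
      · exact _root_.integral_exp_neg_sum_gamma hm hb hh hlaw hind (fun i => hf0 (x.2 i)) x.1
      · exact Measurable.aestronglyMeasurable (by fun_prop)
    _ = _ := by
      rw [integral_map hX.aemeasurable]
      refine Measurable.aestronglyMeasurable
        (measurable_prod_range_count (by fun_prop) fun i => ?_)
      simp_rw [zpow_neg, zpow_natCast]
      fun_prop

/-! ### Alzer's lower bound for the distribution function of the Gamma law -/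

theorem integral_exp_neg_mul_unit {y : ℝ} (hy : 0 < y) :
    ∫ t in (0 : ℝ)..1, Real.exp (-(y * t)) = (1 - Real.exp (-y)) / y := by
  simp_rw [← neg_mul]
  rw [intervalIntegral.integral_comp_mul_left (fun s => Real.exp s) (neg_ne_zero.2 hy.ne'),
    integral_exp]
  simp only [mul_one, mul_zero, Real.exp_zero, smul_eq_mul]
  field_simp
  ring

/-- Jensen's inequality for the convex power `x / y ≥ 1`, applied to `exp(-y t)` with `t` uniform on
`[0, 1]`. -/
theorem one_sub_exp_neg_div_rpow_le {x y : ℝ} (hy : 0 < y) (hyx : y ≤ x) :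
    ((1 - Real.exp (-y)) / y) ^ (x / y) ≤ (1 - Real.exp (-x)) / x := by
  have hprob : IsProbabilityMeasure (volume.restrict (Set.Ioc (0 : ℝ) 1)) := ⟨by simp⟩
  have hint (z : ℝ) : Integrable (fun t => Real.exp (-(z * t)))
      (volume.restrict (Set.Ioc (0 : ℝ) 1)) :=
    (Continuous.integrableOn_Icc (by fun_prop)).mono_set Set.Ioc_subset_Icc_self
  have hcomp : (fun s : ℝ => s ^ (x / y)) ∘ (fun t => Real.exp (-(y * t))) =
      fun t => Real.exp (-(x * t)) := by
    funext t
    rw [Function.comp_apply, ← Real.exp_mul]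
    congr 1
    field_simp
  have h := (convexOn_rpow ((one_le_div hy).2 hyx)).map_integral_le
    (μ := volume.restrict (Set.Ioc (0 : ℝ) 1)) (f := fun t => Real.exp (-(y * t)))
    (continuousOn_id.rpow_const fun _ _ => Or.inr
      (div_nonneg (hy.trans_le hyx).le hy.le)) isClosed_Ici
    (ae_of_all _ fun t => (Real.exp_pos _).le) (hint y) (by rw [hcomp]; exact hint x)
  rw [← intervalIntegral.integral_of_le zero_le_one, integral_exp_neg_mul_unit hy] at h
  refine h.trans_eq ?_
  rw [← integral_exp_neg_mul_unit (hy.trans_le hyx), intervalIntegral.integral_of_le zero_le_one]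
  exact congrArg (fun f => ∫ t in Set.Ioc (0 : ℝ) 1, f t) hcomp

/-- A function on the half line that vanishes at both ends and whose derivative changes sign
at most once, from positive to negative, is nonnegative. -/
theorem nonneg_of_deriv_sign {f f' : ℝ → ℝ} (hf : ContinuousOn f (Set.Ici 0))
    (hd : ∀ x, 0 < x → HasDerivAt f (f' x) x) (h0 : f 0 = 0)
    (hlim : Filter.Tendsto f Filter.atTop (nhds 0))
    (hsign : ∀ x y, 0 < y → y ≤ x → 0 ≤ f' x → 0 ≤ f' y) {x : ℝ} (hx : 0 ≤ x) : 0 ≤ f x := by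
  rcases hx.eq_or_lt with rfl | hx
  · exact h0.ge
  by_cases h : 0 ≤ f' x
  · have hm : MonotoneOn f (Set.Icc 0 x) := by
      refine monotoneOn_of_deriv_nonneg (convex_Icc 0 x) (hf.mono Set.Icc_subset_Ici_self) ?_ ?_
      · rw [interior_Icc]
        exact fun y hy => (hd y hy.1).differentiableAt.differentiableWithinAt
      · rw [interior_Icc]
        intro y hy
        rw [(hd y hy.1).deriv]
        exact hsign x y hy.1 hy.2.le h
    exact h0.ge.trans (hm ⟨le_rfl, hx.le⟩ ⟨hx.le, le_rfl⟩ hx.le)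
  · have hm : AntitoneOn f (Set.Ici x) := by
      refine antitoneOn_of_deriv_nonpos (convex_Ici x)
        (hf.mono (Set.Ici_subset_Ici.2 hx.le)) ?_ ?_
      · rw [interior_Ici]
        exact fun y hy => (hd y (hx.trans hy)).differentiableAt.differentiableWithinAt
      · rw [interior_Ici]
        intro y (hy : x < y)
        rw [(hd y (hx.trans hy)).deriv]
        by_contra hc
        exact h (hsign y x hx hy.le (not_le.1 hc).le)
    refine le_of_tendsto hlim ?_
    filter_upwards [Filter.eventually_ge_atTop x] with y hy using hm Set.self_mem_Ici hy hy

theorem integrable_gammaPDFReal {a r : ℝ} (ha : 0 < a) (hr : 0 < r) :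
    Integrable (gammaPDFReal a r) := by
  refine ⟨(measurable_gammaPDFReal a r).aestronglyMeasurable, ?_⟩
  rw [hasFiniteIntegral_iff_ofReal (ae_of_all _ (gammaPDFReal_nonneg ha hr))]
  exact (lintegral_gammaPDF_eq_one ha hr).trans_lt ENNReal.one_lt_top

theorem cdf_gammaMeasure_zero {a r : ℝ} (ha : 0 < a) (hr : 0 < r) :
    cdf (gammaMeasure a r) 0 = 0 := by
  rw [cdf_gammaMeasure_eq_lintegral ha hr, setLIntegral_congr Iio_ae_eq_Iic.symm,
    lintegral_gammaPDF_of_nonpos le_rfl, ENNReal.toReal_zero]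

theorem hasDerivAt_cdf_gammaMeasure {a r : ℝ} (ha : 0 < a) (hr : 0 < r) {x : ℝ} (hx : 0 < x) :
    HasDerivAt (cdf (gammaMeasure a r)) (gammaPDFReal a r x) x := by
  have hint := integrable_gammaPDFReal ha hr
  have hc : ContinuousAt (gammaPDFReal a r) x := by
    have : ContinuousAt (fun x : ℝ => r ^ a / Real.Gamma a * x ^ (a - 1) * Real.exp (-(r * x))) x :=
      (continuousAt_const.mul (Real.continuousAt_rpow_const x (a - 1) (Or.inl hx.ne'))).mul
        (by fun_prop)
    refine this.congr ?_
    filter_upwards [lt_mem_nhds hx] with y hy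
    rw [gammaPDFReal, if_pos hy.le]
  have h := (intervalIntegral.integral_hasDerivAt_right (a := x) (b := x)
    (IntervalIntegrable.refl) (stronglyMeasurable_gammaPDFReal a r).stronglyMeasurableAtFilter
    hc).const_add (cdf (gammaMeasure a r) x)
  refine h.congr_of_eventuallyEq (Filter.Eventually.of_forall fun y => ?_)
  dsimp only
  rw [cdf_gammaMeasure_eq_integral ha hr, cdf_gammaMeasure_eq_integral ha hr,
    ← intervalIntegral.integral_Iic_sub_Iic hint.integrableOn hint.integrableOn]
  ring

/-- The difference of the two sides vanishes at 0 and at infinity, so it suffices that its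
derivative changes sign at most once, from positive to negative. With `k = m - 1` and `κ = 1 / b -
a`, the derivative at `z > 0` is nonnegative exactly when `((1 - exp(-a z)) / (a z)) ^ k ≤ exp(-κ
z)`. By the Jensen bound above, this condition passes from `x` to every smaller positive `y`. -/
theorem pow_one_sub_exp_le_cdf_gammaMeasure {m : ℕ} (hm : 1 ≤ m) {b : ℝ} (hb : 0 < b) {x : ℝ}
    (hx : 0 ≤ x) :
    (1 - Real.exp (-(((m)! : ℝ) ^ (-(1 / (m : ℝ))) / b * x))) ^ m ≤
      cdf (gammaMeasure m (1 / b)) x := by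
  obtain ⟨k, rfl⟩ : ∃ k, m = k + 1 := ⟨m - 1, by omega⟩
  set a : ℝ := (((k + 1)! : ℕ) : ℝ) ^ (-(1 / ((k + 1 : ℕ) : ℝ))) / b with ha
  have hm0 : (0 : ℝ) < (k + 1 : ℕ) := by positivity
  have hr : 0 < 1 / b := by positivity
  have hfac : (0 : ℝ) < ((k + 1)! : ℕ) := by positivity
  have ha0 : 0 < a := by positivity
  -- This is what the factor `(m!) ^ (-1/m)` is for: both derivatives acquire the same constant `(k
  -- + 1) a`, which then drops out of the sign condition.
  have hapow : a ^ (k + 1) = (1 / b) ^ (k + 1) / ((k + 1)! : ℕ) := by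
    rw [ha, div_pow, ← Real.rpow_natCast (_ ^ _) (k + 1), ← Real.rpow_mul hfac.le, neg_mul,
      one_div_mul_cancel hm0.ne', Real.rpow_neg_one, one_div, inv_pow]
    field_simp
  have hpdf {y : ℝ} (hy : 0 < y) : gammaPDFReal (k + 1 : ℕ) (1 / b) y =
      (k + 1) * a * ((a * y) ^ k * Real.exp (-(1 / b * y))) := by
    have hg : (1 / b) ^ (k + 1) / (k ! : ℝ) = (k + 1) * a ^ (k + 1) := by
      rw [hapow, Nat.factorial_succ]
      push_cast
      field_simp
    rw [gammaPDFReal, if_pos hy.le, Nat.cast_add_one, Real.Gamma_nat_eq_factorial,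
      ← Nat.cast_add_one, Real.rpow_natCast, hg, Nat.cast_add_one, add_sub_cancel_right,
      Real.rpow_natCast]
    ring
  have hsub := nonneg_of_deriv_sign
    (f := fun y => cdf (gammaMeasure (k + 1 : ℕ) (1 / b)) y - (1 - Real.exp (-(a * y))) ^ (k + 1))
    (f' := fun y => gammaPDFReal (k + 1 : ℕ) (1 / b) y -
      (k + 1) * a * ((1 - Real.exp (-(a * y))) ^ k * Real.exp (-(a * y))))
    ?_ ?_ ?_ ?_ ?_ hx
  · exact sub_nonneg.1 hsub
  · refine ContinuousOn.sub (fun y (hy : 0 ≤ y) => ?_) (Continuous.continuousOn (by fun_prop))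
    rcases hy.eq_or_lt with rfl | hy
    · exact (cdf _).right_continuous 0
    · exact (hasDerivAt_cdf_gammaMeasure hm0 hr hy).continuousAt.continuousWithinAt
  · intro y hy
    refine (hasDerivAt_cdf_gammaMeasure hm0 hr hy).sub ?_
    have h1 : HasDerivAt (fun y => 1 - Real.exp (-(a * y))) (a * Real.exp (-(a * y))) y := by
      have := (((hasDerivAt_id y).const_mul a).neg.exp).const_sub 1
      refine this.congr_deriv ?_
      simp only [id, Pi.neg_apply]
      ring
    refine (h1.pow (k + 1)).congr_deriv ?_
    push_cast
    ring
  · rw [cdf_gammaMeasure_zero hm0 hr]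
    simp
  · have h1 : Filter.Tendsto (fun y => (1 - Real.exp (-(a * y))) ^ (k + 1)) Filter.atTop
        (nhds 1) := by
      have := (Real.tendsto_exp_neg_atTop_nhds_zero.comp
        (Filter.tendsto_id.const_mul_atTop ha0)).const_sub 1 |>.pow (k + 1)
      simpa using this
    simpa using (tendsto_cdf_atTop (gammaMeasure (k + 1 : ℕ) (1 / b))).sub h1
  · intro x y hy hyx h
    have hx0 := hy.trans_le hyx
    set κ : ℝ := 1 / b - a with hκ
    have hposA {z : ℝ} (hz : 0 < z) : 0 < (1 - Real.exp (-(a * z))) / (a * z) := by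
      have : Real.exp (-(a * z)) < 1 := Real.exp_lt_one_iff.2 (neg_neg_of_pos (mul_pos ha0 hz))
      have : 0 < 1 - Real.exp (-(a * z)) := by linarith
      positivity
    have hiff {z : ℝ} (hz : 0 < z) : (0 ≤ gammaPDFReal (k + 1 : ℕ) (1 / b) z -
        (k + 1) * a * ((1 - Real.exp (-(a * z))) ^ k * Real.exp (-(a * z)))) ↔
        ((1 - Real.exp (-(a * z))) / (a * z)) ^ k ≤ Real.exp (-(κ * z)) := by
      have haz : 0 < (a * z) ^ k := by positivity
      rw [hpdf hz, ← mul_sub, mul_nonneg_iff_of_pos_left (by positivity), sub_nonneg, div_pow,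
        div_le_iff₀ haz, ← le_div_iff₀ (Real.exp_pos _), mul_div_assoc, ← Real.exp_sub,
        show -(1 / b * z) - -(a * z) = -(κ * z) by rw [hκ]; ring, mul_comm (Real.exp _)]
    rw [hiff hx0] at h
    rw [hiff hy]
    have hJ := one_sub_exp_neg_div_rpow_le (mul_pos ha0 hy) (mul_le_mul_of_nonneg_left hyx ha0.le)
    rw [mul_div_mul_left _ _ ha0.ne'] at hJ
    -- Raising to the power `x / y` turns `exp(-κ y)` into `exp(-κ x)`, so the condition at `x`
    -- gives the one at `y` raised to `x / y`; that positive power is then removed.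
    have hJ' : (((1 - Real.exp (-(a * y))) / (a * y)) ^ k) ^ (x / y) ≤
        (Real.exp (-(κ * y))) ^ (x / y) := by
      rw [← Real.exp_mul, show -(κ * y) * (x / y) = -(κ * x) by field_simp]
      refine le_trans ?_ h
      rw [← Real.rpow_natCast, ← Real.rpow_mul (hposA hy).le, mul_comm (k : ℝ),
        Real.rpow_mul (hposA hy).le,
        Real.rpow_natCast]
      exact pow_le_pow_left₀ (Real.rpow_nonneg (hposA hy).le _) hJ k
    exact (Real.rpow_le_rpow_iff (pow_nonneg (hposA hy).le k) (Real.exp_pos _).le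
      (div_pos hx0 hy)).1 hJ'

theorem cdf_gammaMeasure_one {r : ℝ} (hr : 0 < r) {x : ℝ} (hx : 0 ≤ x) :
    cdf (gammaMeasure 1 r) x = 1 - Real.exp (-(r * x)) := by
  have := cdf_expMeasure_eq hr x
  rwa [if_pos hx] at this

/-! ### Geometry and deterministic functions of the uplink -/

theorem intervalIntegral_ite_lt {m b : ℝ} (hm : 0 ≤ m) (hmb : m ≤ b) (f : ℝ → ℝ) :
    ∫ θ in (0 : ℝ)..b, (if θ < m then f θ else 0) = ∫ θ in (0 : ℝ)..m, f θ := by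
  have h : (fun θ => if θ < m then f θ else 0) = (Set.Iio m).indicator f := by
    funext θ
    simp [Set.indicator]
  have hs : Set.Iio m ∩ Set.Ioc 0 b = Set.Ioo 0 m := by
    ext θ
    simp only [Set.mem_inter_iff, Set.mem_Iio, Set.mem_Ioc, Set.mem_Ioo]
    constructor
    · rintro ⟨h1, h2, -⟩
      exact ⟨h2, h1⟩
    · rintro ⟨h1, h2⟩
      exact ⟨h2, h1, h2.le.trans hmb⟩
  rw [intervalIntegral.integral_of_le (hm.trans hmb), intervalIntegral.integral_of_le hm, h,
    integral_indicator measurableSet_Iio, Measure.restrict_restrict measurableSet_Iio, hs,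
    integral_Ioc_eq_integral_Ioo]

theorem measurable_angle_comp {α : Type*} [MeasurableSpace α] {f g : α → E3} (hf : Measurable f)
    (hg : Measurable g) : Measurable fun a => InnerProductGeometry.angle (f a) (g a) :=
  Real.measurable_arccos.comp ((hf.inner hg).div (hf.norm.mul hg.norm))

namespace Uplink

variable {K : ℕ} (S : Uplink K) (k : Fin K)

theorem RE_lt_R : S.RE < S.R k := lt_add_of_pos_left _ (S.alt_pos k)

theorem R_pos : 0 < S.R k := S.RE_pos.trans (S.RE_lt_R k)

theorem thetaMax_nonneg_le_pi : 0 ≤ S.thetaMax k ∧ S.thetaMax k ≤ Real.pi := by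
  have hR := S.R_pos k
  rw [thetaMax]
  split_ifs with h
  · have hb2 : S.beam ≤ Real.pi / 2 := h.le.trans (Real.arcsin_le_pi_div_two _)
    have hs : 0 ≤ Real.sin S.beam :=
      Real.sin_nonneg_of_nonneg_of_le_pi S.beam_pos.le (by linarith [Real.pi_pos])
    have h1 : S.beam ≤ Real.arcsin (S.R k / S.RE * Real.sin S.beam) := by
      rw [← Real.arcsin_sin (by linarith [S.beam_pos, Real.pi_pos]) hb2]
      refine Real.monotone_arcsin ?_
      rw [Real.arcsin_sin (by linarith [S.beam_pos, Real.pi_pos]) hb2]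
      exact le_mul_of_one_le_left hs ((one_le_div S.RE_pos).2 (S.RE_lt_R k).le)
    exact ⟨sub_nonneg.2 h1, by
      linarith [Real.arcsin_le_pi_div_two (S.R k / S.RE * Real.sin S.beam), S.beam_pos,
        Real.pi_pos]⟩
  · exact ⟨Real.arccos_nonneg _, Real.arccos_le_pi _⟩

theorem distAt_pos (θ : ℝ) : 0 < S.distAt k θ := by
  refine Real.sqrt_pos.2 ?_
  have h1 := mul_le_mul_of_nonneg_left (Real.cos_le_one θ) (mul_pos S.RE_pos (S.R_pos k)).le
  have h2 := pow_pos (sub_pos.2 (S.RE_lt_R k)) 2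
  nlinarith

theorem dist_eq_distAt {x u : E3} (hx : ‖x‖ = S.R k) (hu : ‖u‖ = S.RE) :
    dist x u = S.distAt k (InnerProductGeometry.angle x u) := by
  rw [distAt, dist_eq_norm, ← Real.sqrt_sq (norm_nonneg (x - u)), sq ‖x - u‖,
    InnerProductGeometry.norm_sub_sq_eq_norm_sq_add_norm_sq_sub_two_mul_norm_mul_norm_mul_cos_angle,
    hx, hu]
  ring_nf

theorem norm_typical : ‖S.typical‖ = S.RE := by
  rw [EuclideanSpace.norm_eq]
  simp [typical, Fin.sum_univ_three, Real.sqrt_sq S.RE_pos.le]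

theorem typical_ne_zero : S.typical ≠ 0 := by
  rw [← norm_pos_iff, norm_typical]
  exact S.RE_pos

theorem recPower_eq_mul (d h : ℝ) : S.recPower d h = S.recPower d 1 * h := by
  simp [recPower]

theorem recPower_one_nonneg (d : ℝ) : 0 ≤ S.recPower d 1 := by
  have := S.Pt_pos
  have := S.G_pos
  rw [recPower]
  positivity

theorem recPower_one_pos {d : ℝ} (hd : 0 < d) : 0 < S.recPower d 1 := by
  have := S.Pt_pos
  have := S.G_pos
  have := S.c_pos
  have := S.f_pos
  rw [recPower]
  positivity

theorem measurable_recPower {α : Type*} [MeasurableSpace α] {f g : α → ℝ} (hf : Measurable f)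
    (hg : Measurable g) : Measurable fun a => S.recPower (f a) (g a) := by
  unfold recPower
  fun_prop

theorem measurable_distAt : Measurable (S.distAt k) := by
  unfold distAt
  fun_prop

theorem measurable_sES (β : ℝ) : Measurable (S.sES β k) := by
  have := S.measurable_distAt k
  unfold sES
  fun_prop

theorem laplaceInterference_eq (s : ℝ) :
    S.laplaceInterference k s = Real.exp (-(S.dens * (2 * Real.pi * S.RE ^ 2 *
      ∫ θ in (0 : ℝ)..(S.thetaMax k),
        (1 - (1 + S.m₂ * (s * S.recPower (S.distAt k θ) 1)) ^ (-(S.m₁ : ℤ))) * Real.sin θ))) := by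
  rw [laplaceInterference, intervalIntegral.integral_const, smul_eq_mul, sub_zero, neg_mul,
    mul_assoc (2 * Real.pi), ← intervalIntegral.integral_const_mul (S.RE ^ 2)]
  congr! 6
  simp only [recPower]
  ring_nf

theorem one_sub_zpow_mem_Icc {t : ℝ} (ht : 0 ≤ t) :
    1 - (1 + S.m₂ * t) ^ (-(S.m₁ : ℤ)) ∈ Set.Icc (0 : ℝ) 1 := by
  have h1 : 1 ≤ 1 + S.m₂ * t := le_add_of_nonneg_right (mul_nonneg S.m₂_pos.le ht)
  rw [zpow_neg, zpow_natCast]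
  have h2 := inv_le_one_of_one_le₀ (one_le_pow₀ h1 (n := S.m₁))
  have h3 : 0 ≤ ((1 + S.m₂ * t) ^ S.m₁)⁻¹ := by positivity
  exact ⟨by linarith, by linarith⟩

theorem laplaceInterference_le_one {s : ℝ} (hs : 0 ≤ s) : S.laplaceInterference k s ≤ 1 := by
  have hθ := S.thetaMax_nonneg_le_pi k
  rw [laplaceInterference_eq, Real.exp_le_one_iff, neg_nonpos]
  have := S.dens_pos
  have := Real.pi_pos
  have : 0 ≤ ∫ θ in (0 : ℝ)..(S.thetaMax k),
      (1 - (1 + S.m₂ * (s * S.recPower (S.distAt k θ) 1)) ^ (-(S.m₁ : ℤ))) * Real.sin θ :=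
    intervalIntegral.integral_nonneg hθ.1 fun θ h => mul_nonneg
      (S.one_sub_zpow_mem_Icc (mul_nonneg hs (S.recPower_one_nonneg _))).1
      (Real.sin_nonneg_of_nonneg_of_le_pi h.1 (h.2.trans hθ.2))
  positivity

theorem measurable_laplaceInterference : Measurable (S.laplaceInterference k) := by
  have hK : Measurable fun p : ℝ × ℝ =>
      (1 - (1 + S.m₂ * (p.1 * S.recPower (S.distAt k p.2) 1)) ^ (-(S.m₁ : ℤ))) * Real.sin p.2 := by
    have := S.measurable_recPower ((S.measurable_distAt k).comp
      (measurable_snd (α := ℝ) (β := ℝ))) (measurable_const (a := (1 : ℝ)))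
    simp only [Function.comp_apply] at this
    simp_rw [zpow_neg, zpow_natCast]
    fun_prop
  have hI := (hK.stronglyMeasurable.integral_prod_right'
    (ν := volume.restrict (Set.Ioc 0 (S.thetaMax k)))).measurable
  have heq : S.laplaceInterference k = fun s => Real.exp (-(S.dens * (2 * Real.pi * S.RE ^ 2 *
      ∫ θ in Set.Ioc 0 (S.thetaMax k),
        (1 - (1 + S.m₂ * (s * S.recPower (S.distAt k θ) 1)) ^ (-(S.m₁ : ℤ))) * Real.sin θ))) := by
    funext s
    rw [laplaceInterference_eq, intervalIntegral.integral_of_le (S.thetaMax_nonneg_le_pi k).1]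
  rw [heq]
  exact ((hI.const_mul _).const_mul _).neg.exp

theorem sES_nonneg {β : ℝ} (hβ : 0 < β) (hβγ : β * (1 - S.γ) < S.γ) (θ : ℝ) :
    0 ≤ S.sES β k θ := by
  have := S.Pt_pos
  have := S.G_pos
  have := S.m₂_pos
  have := sub_pos.2 hβγ
  rw [sES]
  positivity

/-- The distribution function of the gain at `t`, with `t` the least gain for which the SINR
reaches `β` when the interference is `i`, expanded into exponentials. -/
theorem approxCDF_eq_sum {β : ℝ} (hβγ : β * (1 - S.γ) < S.γ) (θ i : ℝ) :
    S.approxCDF (β * (i + S.noise) / ((S.γ - β * (1 - S.γ)) * S.recPower (S.distAt k θ) 1)) =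
      ∑ q ∈ Finset.range (S.m₁ + 1), ((S.m₁.choose q : ℕ) : ℝ) * (-1) ^ q *
        (Real.exp (-(q * S.sES β k θ * S.noise)) * Real.exp (-(q * S.sES β k θ * i))) := by
  -- `sES` is the exponential rate of `approxCDF` times the coefficient of `i + noise` in the
  -- threshold.
  have h1 : ((S.m₁)! : ℝ) ^ (-(1 / (S.m₁ : ℝ))) / S.m₂ *
      (β * (i + S.noise) / ((S.γ - β * (1 - S.γ)) * S.recPower (S.distAt k θ) 1)) =
      S.sES β k θ * (i + S.noise) := by
    have := S.Pt_pos
    have := S.G_pos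
    have := S.m₂_pos
    have := S.c_pos
    have := S.f_pos
    have := Real.pi_pos
    have := sub_pos.2 hβγ
    have := S.distAt_pos k θ
    rw [sES, recPower]
    field_simp
  rw [approxCDF, h1, sub_eq_neg_add, add_pow]
  refine Finset.sum_congr rfl fun q _ => ?_
  rw [one_pow, mul_one, neg_pow, ← Real.exp_nat_mul, ← Real.exp_add,
    show (q : ℝ) * -(S.sES β k θ * (i + S.noise)) =
      -(q * S.sES β k θ * S.noise) + -(q * S.sES β k θ * i) by ring]
  ring

theorem approxCDF_mem_Icc {t : ℝ} (ht : 0 ≤ t) : S.approxCDF t ∈ Set.Icc (0 : ℝ) 1 := by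
  have := S.m₂_pos
  have h1 : Real.exp (-(((S.m₁)! : ℝ) ^ (-(1 / (S.m₁ : ℝ))) / S.m₂ * t)) ≤ 1 := by
    rw [Real.exp_le_one_iff, neg_nonpos]
    positivity
  have h2 := Real.exp_pos (-(((S.m₁)! : ℝ) ^ (-(1 / (S.m₁ : ℝ))) / S.m₂ * t))
  exact ⟨pow_nonneg (by linarith) _, pow_le_one₀ (by linarith) (by linarith)⟩

theorem continuous_approxCDF : Continuous S.approxCDF := by
  unfold approxCDF
  fun_prop

/-- The conditional probability that an eavesdropper at central angle `θ` has an SINR below `β`,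
for the approximating distribution function. -/
def outageAt (β θ : ℝ) : ℝ :=
  ∑ q ∈ Finset.range (S.m₁ + 1), ((S.m₁.choose q : ℕ) : ℝ) * (-1) ^ q *
    (Real.exp (-(q * S.sES β k θ * S.noise)) * S.laplaceInterference k (q * S.sES β k θ))

theorem measurable_outageAt (β : ℝ) : Measurable (S.outageAt k β) := by
  have h1 := S.measurable_sES k β
  have h2 := S.measurable_laplaceInterference k
  unfold outageAt
  fun_prop

/-- Beyond `thetaMax` the satellite is in outage with certainty, and the weight `sin θ / 2`
integrates there to `(1 + cos θmax) / 2`. -/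
theorem integral_outageAt {β : ℝ} (hβ : 0 < β) (hβγ : β * (1 - S.γ) < S.γ) :
    ∫ θ in (0 : ℝ)..Real.pi,
      (if θ < S.thetaMax k then S.outageAt k β θ else 1) * (Real.sin θ / 2) =
      S.tierFactor β k := by
  have hθ := S.thetaMax_nonneg_le_pi k
  have hint (q : ℕ) : IntervalIntegrable (fun θ => Real.exp (-(q * S.sES β k θ * S.noise)) *
      S.laplaceInterference k (q * S.sES β k θ) * (Real.sin θ / 2)) volume 0 (S.thetaMax k) := by
    rw [intervalIntegrable_iff]
    refine Measure.integrableOn_of_bounded (M := 1) (by simp) ?_ (ae_of_all _ fun θ => ?_)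
    · have h1 := S.measurable_sES k β
      have h2 := S.measurable_laplaceInterference k
      exact Measurable.aestronglyMeasurable (by fun_prop)
    · have hs : 0 ≤ (q : ℝ) * S.sES β k θ := mul_nonneg q.cast_nonneg (S.sES_nonneg k hβ hβγ θ)
      have h1 : Real.exp (-(q * S.sES β k θ * S.noise)) ≤ 1 := by
        rw [Real.exp_le_one_iff, neg_nonpos]
        exact mul_nonneg hs S.noise_pos.le
      have h2 := S.laplaceInterference_le_one k hs
      have h3 : 0 ≤ S.laplaceInterference k (q * S.sES β k θ) := (Real.exp_pos _).le
      have h4 : |Real.sin θ / 2| ≤ 1 := by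
        rw [abs_div, abs_two]
        linarith [Real.abs_sin_le_one θ]
      rw [norm_mul, norm_mul, Real.norm_of_nonneg (Real.exp_pos _).le, Real.norm_of_nonneg h3]
      exact mul_le_one₀ (mul_le_one₀ h1 h3 h2) (norm_nonneg _) h4
  have hint' : IntervalIntegrable (fun θ => S.outageAt k β θ * (Real.sin θ / 2)) volume 0
      (S.thetaMax k) := by
    have : (fun θ => S.outageAt k β θ * (Real.sin θ / 2)) = fun θ =>
        ∑ q ∈ Finset.range (S.m₁ + 1), ((S.m₁.choose q : ℕ) : ℝ) * (-1) ^ q *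
          (Real.exp (-(q * S.sES β k θ * S.noise)) *
            S.laplaceInterference k (q * S.sES β k θ) * (Real.sin θ / 2)) := by
      funext θ
      rw [outageAt, Finset.sum_mul]
      exact Finset.sum_congr rfl fun q _ => by ring
    rw [this]
    have hsum := IntervalIntegrable.sum (Finset.range (S.m₁ + 1)) fun q _ =>
      (hint q).const_mul (((S.m₁.choose q : ℕ) : ℝ) * (-1) ^ q)
    simpa only [Finset.sum_fn] using hsum
  have hcont : IntervalIntegrable (fun θ => Real.sin θ / 2) volume 0 (S.thetaMax k) :=
    Continuous.intervalIntegrable (by fun_prop) _ _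
  -- Subtracting 1 from the conditional probability makes the remaining integrand vanish off the
  -- cap; the subtracted part integrates to 1 over `[0, π]`.
  have hsplit (θ : ℝ) : (if θ < S.thetaMax k then S.outageAt k β θ else 1) * (Real.sin θ / 2) =
      (if θ < S.thetaMax k then S.outageAt k β θ * (Real.sin θ / 2) - Real.sin θ / 2 else 0) +
        Real.sin θ / 2 := by
    split_ifs <;> ring
  simp_rw [hsplit]
  rw [intervalIntegral.integral_add, intervalIntegral_ite_lt hθ.1 hθ.2,
    intervalIntegral.integral_sub hint' hcont]
  · simp only [outageAt, Finset.sum_mul, tierFactor]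
    rw [intervalIntegral.integral_finsetSum]
    · simp only [intervalIntegral.integral_div, integral_sin, mul_assoc,
        intervalIntegral.integral_const_mul, Real.cos_zero, Real.cos_pi]
      ring
    · intro q _
      convert (hint q).const_mul (((S.m₁.choose q : ℕ) : ℝ) * (-1) ^ q) using 2
      ring
  · have : IntervalIntegrable (fun θ => S.outageAt k β θ * (Real.sin θ / 2) - Real.sin θ / 2)
        volume 0 (S.thetaMax k) := hint'.sub hcont
    rw [intervalIntegrable_iff, Set.uIoc_of_le (hθ.1.trans hθ.2)]
    rw [intervalIntegrable_iff, Set.uIoc_of_le hθ.1] at this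
    have h2 := this.mono_set Set.Ioo_subset_Ioc_self
    have h3 : (fun θ => if θ < S.thetaMax k then S.outageAt k β θ * (Real.sin θ / 2) -
        Real.sin θ / 2 else 0) = (Set.Iio (S.thetaMax k)).indicator
        (fun θ => S.outageAt k β θ * (Real.sin θ / 2) - Real.sin θ / 2) := by
      funext θ
      simp [Set.indicator]
    rw [h3, IntegrableOn, integrable_indicator_iff measurableSet_Iio, IntegrableOn,
      Measure.restrict_restrict measurableSet_Iio]
    refine h2.mono_set fun θ hθ' => ⟨hθ'.2.1, hθ'.1⟩
  · exact Continuous.intervalIntegrable (by fun_prop) _ _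

end Uplink

/-! ### One eavesdropper -/

/-- The interfering devices and their fading gains. -/
abbrev Interferers : Type := (ℕ × (ℕ → E3)) × (ℕ → ℝ)

namespace Uplink

variable {K : ℕ} (S : Uplink K) (k : Fin K)

open Classical in
/-- Interference power at a satellite of tier `k` located at `x`. -/
def interferenceAt (x : E3) (y : Interferers) : ℝ :=
  ∑ i ∈ Finset.range y.1.1,
    if InnerProductGeometry.angle x (y.1.2 i) < S.thetaMax k then
      S.recPower (dist x (y.1.2 i)) (y.2 i)
    else 0

open Classical in
/-- SINR at a satellite of tier `k` located at `x`, when the typical device has gain `h`. -/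
def sinrAt (x : E3) (h : ℝ) (y : Interferers) : ℝ :=
  if InnerProductGeometry.angle x S.typical < S.thetaMax k then
    S.γ * S.recPower (dist x S.typical) h /
      ((1 - S.γ) * S.recPower (dist x S.typical) h + S.interferenceAt k x y + S.noise)
  else 0

/-- The gain of the typical device from which on the SINR is at least `β`. -/
def gainThreshold (β : ℝ) (x : E3) (y : Interferers) : ℝ :=
  β * (S.interferenceAt k x y + S.noise) /
    ((S.γ - β * (1 - S.γ)) * S.recPower (dist x S.typical) 1)

theorem measurable_interferenceAt :
    Measurable fun p : E3 × Interferers => S.interferenceAt k p.1 p.2 := by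
  refine measurable_sum_range_count (by fun_prop) fun i => Measurable.ite ?_ ?_ measurable_const
  · exact measurableSet_lt (measurable_angle_comp (by fun_prop) (by fun_prop)) measurable_const
  · exact S.measurable_recPower (Measurable.dist (by fun_prop) (by fun_prop)) (by fun_prop)

theorem measurable_gainThreshold (β : ℝ) :
    Measurable fun p : E3 × Interferers => S.gainThreshold k β p.1 p.2 := by
  have h1 := S.measurable_interferenceAt k
  have h2 : Measurable fun p : E3 × Interferers => S.recPower (dist p.1 S.typical) 1 :=
    S.measurable_recPower (Measurable.dist (by fun_prop) (by fun_prop)) (by fun_prop)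
  unfold gainThreshold
  fun_prop

theorem measurable_sinrAt :
    Measurable fun p : E3 × ℝ × Interferers => S.sinrAt k p.1 p.2.1 p.2.2 := by
  have hproj : Measurable fun p : E3 × ℝ × Interferers => (p.1, p.2.2) :=
    measurable_fst.prodMk (measurable_snd.comp measurable_snd)
  have h1 : Measurable fun p : E3 × ℝ × Interferers => S.interferenceAt k p.1 p.2.2 := by
    have := (S.measurable_interferenceAt k).comp hproj
    exact this
  have h2 : Measurable fun p : E3 × ℝ × Interferers => S.recPower (dist p.1 S.typical) p.2.1 :=
    S.measurable_recPower (Measurable.dist (by fun_prop) (by fun_prop)) (by fun_prop)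
  have hcov : MeasurableSet {p : E3 × ℝ × Interferers |
      InnerProductGeometry.angle p.1 S.typical < S.thetaMax k} :=
    measurableSet_lt (measurable_angle_comp measurable_fst measurable_const) measurable_const
  unfold sinrAt
  exact Measurable.ite hcov (by fun_prop) measurable_const

theorem interferenceAt_nonneg (x : E3) {y : Interferers} (hy : ∀ i, 0 ≤ y.2 i) :
    0 ≤ S.interferenceAt k x y := by
  refine Finset.sum_nonneg fun i _ => ?_
  split_ifs
  · rw [recPower_eq_mul]
    exact mul_nonneg (S.recPower_one_nonneg _) (hy i)
  · exact le_rfl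

theorem dist_typical_pos {x : E3} (hx : ‖x‖ = S.R k) : 0 < dist x S.typical := by
  rw [S.dist_eq_distAt k hx S.norm_typical]
  exact S.distAt_pos k _

theorem gainThreshold_pos {β : ℝ} (hβ : 0 < β) (hβγ : β * (1 - S.γ) < S.γ) {x : E3}
    (hx : ‖x‖ = S.R k) {y : Interferers} (hy : ∀ i, 0 ≤ y.2 i) : 0 < S.gainThreshold k β x y := by
  have h1 := S.recPower_one_pos (S.dist_typical_pos k hx)
  have h2 := sub_pos.2 hβγ
  have h3 := add_pos_of_nonneg_of_pos (S.interferenceAt_nonneg k x hy) S.noise_pos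
  rw [gainThreshold]
  positivity

/-- Collecting the terms in `h` gives the coefficient `γ - β (1 - γ)`, positive by hypothesis, so
the division keeps the direction. Without coverage the SINR is 0, which is below `β`. -/
theorem sinrAt_lt_iff {β : ℝ} (hβ : 0 < β) (hβγ : β * (1 - S.γ) < S.γ) {x : E3}
    (hx : ‖x‖ = S.R k) {h : ℝ} (hh : 0 ≤ h) {y : Interferers} (hy : ∀ i, 0 ≤ y.2 i) :
    S.sinrAt k x h y < β ↔ (InnerProductGeometry.angle x S.typical < S.thetaMax k →
      h < S.gainThreshold k β x y) := by
  rw [sinrAt]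
  split_ifs with hc
  · have h1 := S.recPower_one_pos (S.dist_typical_pos k hx)
    have h2 := sub_pos.2 hβγ
    have h3 := S.interferenceAt_nonneg k x hy
    have h4 := mul_nonneg (sub_nonneg.2 S.γ_le_one) (mul_nonneg h1.le hh)
    rw [recPower_eq_mul, div_lt_iff₀ (by linarith [S.noise_pos]), gainThreshold,
      lt_div_iff₀ (mul_pos h2 h1)]
    simp only [hc, true_imp_iff]
    constructor <;> intro h <;> linarith
  · simp [hc, hβ]

end Uplink

/-! ### Outage probability of a single eavesdropper -/

namespace EveData

variable {Ω : Type*} {K : ℕ}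

namespace HasModelLaw

variable [MeasurableSpace Ω] {P : Measure Ω} {D : EveData Ω}
  {S : Uplink K} {k : Fin K} {ν : Measure ℝ}

theorem measurable_interferers (h : D.HasModelLaw S k ν P) :
    Measurable fun ω => (D.all ω).2.2 :=
  (h.devices.measurable_count.prodMk (measurable_pi_lambda _ h.devices.measurable_point)).prodMk
    (measurable_pi_lambda _ h.measurable_devGain)

theorem measurable_all (h : D.HasModelLaw S k ν P) : Measurable D.all :=
  h.measurable_pos.prodMk (h.measurable_gain.prodMk h.measurable_interferers)

theorem isProbabilityMeasure_gain [IsProbabilityMeasure P] (h : D.HasModelLaw S k ν P) :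
    IsProbabilityMeasure ν := by
  rw [← h.gain_law]
  exact Measure.isProbabilityMeasure_map h.measurable_gain.aemeasurable

theorem isProbabilityMeasure_uniformSphere [IsProbabilityMeasure P] (h : D.HasModelLaw S k ν P) :
    IsProbabilityMeasure (uniformSphere (S.R k)) := by
  rw [← h.pos_law]
  exact Measure.isProbabilityMeasure_map h.measurable_pos.aemeasurable

theorem map_all [IsProbabilityMeasure P] (h : D.HasModelLaw S k ν P) :
    P.map D.all = (uniformSphere (S.R k)).prod (ν.prod (P.map fun ω => (D.all ω).2.2)) := by
  have h1 := (indepFun_iff_map_prod_eq_prod_map_map h.measurable_pos.aemeasurable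
    (h.measurable_all.snd).aemeasurable).1 h.indep_pos
  have h2 := (indepFun_iff_map_prod_eq_prod_map_map h.measurable_gain.aemeasurable
    h.measurable_interferers.aemeasurable).1 h.indep_gain
  rw [h.pos_law] at h1
  rw [h.gain_law] at h2
  rw [← h2]
  exact h1

theorem ae_interferers_nonneg (h : D.HasModelLaw S k ν P) :
    ∀ᵐ y ∂(P.map fun ω => (D.all ω).2.2), ∀ i, 0 ≤ y.2 i := by
  rw [ae_map_iff h.measurable_interferers.aemeasurable (by
    rw [Set.ofPred_forall]
    exact MeasurableSet.iInter fun i => measurableSet_le measurable_const (by fun_prop)),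
    ae_all_iff]
  intro i
  have : ∀ᵐ x ∂P.map (D.devGain i), 0 ≤ x := by
    rw [h.devGain_law i, ae_iff]
    simp only [not_le]
    exact gammaMeasure_Iio_zero _ _
  exact ae_of_ae_map (h.measurable_devGain i).aemeasurable this

theorem ae_norm_uniformSphere (S : Uplink K) (k : Fin K) :
    ∀ᵐ x ∂uniformSphere (S.R k), ‖x‖ = S.R k :=
  Measure.ae_smul_measure (ae_norm_sphereArea (S.R_pos k).le) _

/-- The Laplace transform of the interference at a fixed position of the satellite. -/
theorem integral_exp_neg_interferenceAt [IsProbabilityMeasure P] (h : D.HasModelLaw S k ν P)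
    {x : E3} (hx : ‖x‖ = S.R k)
    {s : ℝ} (hs : 0 ≤ s) :
    ∫ y, Real.exp (-(s * S.interferenceAt k x y)) ∂(P.map fun ω => (D.all ω).2.2) =
      S.laplaceInterference k s := by
  -- Both `s` and the coverage indicator are absorbed into a nonnegative function of the device's
  -- position, which makes the exponent a marked Poisson sum.
  let f : E3 → ℝ := fun u => if InnerProductGeometry.angle x u < S.thetaMax k then
    s * S.recPower (dist x u) 1 else 0
  have hf : Measurable f := by
    refine Measurable.ite (measurableSet_lt measurable_angle measurable_const) ?_ measurable_const
    exact (S.measurable_recPower (Measurable.dist measurable_const measurable_id)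
      measurable_const).const_mul s
  have hf0 (u : E3) : 0 ≤ f u := by
    dsimp only [f]
    split_ifs
    · exact mul_nonneg hs (S.recPower_one_nonneg _)
    · exact le_rfl
  have hsum (ω : Ω) : s * S.interferenceAt k x (D.all ω).2.2 =
      ∑ i ∈ Finset.range (D.n ω), f (D.dev i ω) * D.devGain i ω := by
    rw [Uplink.interferenceAt, Finset.mul_sum]
    refine Finset.sum_congr rfl fun i _ => ?_
    change s * (if InnerProductGeometry.angle x (D.dev i ω) < S.thetaMax k then
      S.recPower (dist x (D.dev i ω)) (D.devGain i ω) else 0) = f (D.dev i ω) * D.devGain i ω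
    dsimp only [f]
    by_cases hc : InnerProductGeometry.angle x (D.dev i ω) < S.thetaMax k
    · rw [if_pos hc, if_pos hc, S.recPower_eq_mul _ (D.devGain i ω), mul_assoc]
    · rw [if_neg hc, if_neg hc, mul_zero, zero_mul]
  have hmeas : Measurable fun y : Interferers => Real.exp (-(s * S.interferenceAt k x y)) :=
    (((S.measurable_interferenceAt k).comp measurable_prodMk_left).const_mul s).neg.exp
  rw [integral_map h.measurable_interferers.aemeasurable hmeas.aestronglyMeasurable]
  simp_rw [hsum]
  rw [h.devices.integral_exp_neg_sum_gamma S.m₁_pos S.m₂_pos h.measurable_devGain h.devGain_law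
    h.devGain_indep h.indep_devices hf hf0, S.laplaceInterference_eq k s, integral_smul_measure,
    ENNReal.toReal_ofReal S.dens_pos.le, smul_eq_mul]
  have hθ := S.thetaMax_nonneg_le_pi k
  have hx0 : x ≠ 0 := by
    rw [← norm_pos_iff, hx]
    exact S.R_pos k
  let g : ℝ → ℝ := fun θ => if θ < S.thetaMax k then
    1 - (1 + S.m₂ * (s * S.recPower (S.distAt k θ) 1)) ^ (-(S.m₁ : ℤ)) else 0
  have hg : Measurable g := by
    refine Measurable.ite (measurableSet_lt measurable_id measurable_const) ?_ measurable_const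
    have := S.measurable_recPower (S.measurable_distAt k) (measurable_const (a := (1 : ℝ)))
    simp_rw [zpow_neg, zpow_natCast]
    fun_prop
  -- The equality is only almost everywhere: the distance is a function of the angle only on the
  -- sphere of radius `RE`.
  have hfg : (fun u => 1 - (1 + S.m₂ * f u) ^ (-(S.m₁ : ℤ))) =ᵐ[sphereArea S.RE]
      fun u => g (InnerProductGeometry.angle x u) := by
    filter_upwards [ae_norm_sphereArea S.RE_pos.le] with u hu
    dsimp only [f, g]
    split_ifs
    · rw [S.dist_eq_distAt k hx hu]
    · simp
  rw [integral_congr_ae hfg, integral_comp_angle_sphereArea hx0 S.RE_pos hg,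
    ← intervalIntegral_ite_lt hθ.1 hθ.2]
  simp only [g, ite_mul, zero_mul]

theorem isProbabilityMeasure_interferers [IsProbabilityMeasure P] (h : D.HasModelLaw S k ν P) :
    IsProbabilityMeasure (P.map fun ω => (D.all ω).2.2) :=
  Measure.isProbabilityMeasure_map h.measurable_interferers.aemeasurable

/-- Conditioning on the position of the satellite and on the interfering devices. -/
theorem prob_sinr_lt [IsProbabilityMeasure P] (h : D.HasModelLaw S k ν P) {β : ℝ} (hβ : 0 < β)
    (hβγ : β * (1 - S.γ) < S.γ) (hν : ν (Set.Iio 0) = 0) :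
    P.real {ω | D.sinr S k ω < β} = ∫ x, ∫ y,
      (if InnerProductGeometry.angle x S.typical < S.thetaMax k then
        ν.real (Set.Iio (S.gainThreshold k β x y)) else 1)
      ∂(P.map fun ω => (D.all ω).2.2) ∂uniformSphere (S.R k) := by
  have := h.isProbabilityMeasure_gain
  have := h.isProbabilityMeasure_uniformSphere
  have := h.isProbabilityMeasure_interferers
  let A : Set (E3 × ℝ × Interferers) := {p | S.sinrAt k p.1 p.2.1 p.2.2 < β}
  let B : Set (E3 × ℝ × Interferers) := {p |
    InnerProductGeometry.angle p.1 S.typical < S.thetaMax k → p.2.1 < S.gainThreshold k β p.1 p.2.2}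
  have hA : MeasurableSet A := measurableSet_lt (S.measurable_sinrAt k) measurable_const
  have hB : MeasurableSet B := by
    have h1 : MeasurableSet {p : E3 × ℝ × Interferers |
        InnerProductGeometry.angle p.1 S.typical < S.thetaMax k} :=
      measurableSet_lt (measurable_angle_comp measurable_fst measurable_const) measurable_const
    have hproj : Measurable fun p : E3 × ℝ × Interferers => (p.1, p.2.2) :=
      measurable_fst.prodMk (measurable_snd.comp measurable_snd)
    have h2 : Measurable fun p : E3 × ℝ × Interferers => S.gainThreshold k β p.1 p.2.2 := by
      have := (S.measurable_gainThreshold k β).comp hproj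
      exact this
    have h3 : MeasurableSet {p : E3 × ℝ × Interferers | p.2.1 < S.gainThreshold k β p.1 p.2.2} :=
      measurableSet_lt (by fun_prop) h2
    exact h1.imp h3
  -- The equivalence with the gain threshold needs the satellite on its sphere and nonnegative
  -- gains, which hold almost surely under the product law.
  have hAB : A =ᵐ[(uniformSphere (S.R k)).prod (ν.prod (P.map fun ω => (D.all ω).2.2))] B := by
    have h1 := Measure.quasiMeasurePreserving_fst (μ := uniformSphere (S.R k))
      (ν := ν.prod (P.map fun ω => (D.all ω).2.2)) |>.ae (ae_norm_uniformSphere S k)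
    have hν' : ∀ᵐ t ∂ν, 0 ≤ t := by
      rw [ae_iff]
      simp only [not_le]
      exact hν
    have h2 := Measure.quasiMeasurePreserving_snd (μ := uniformSphere (S.R k)) |>.ae
      (Measure.quasiMeasurePreserving_fst (μ := ν) (ν := P.map fun ω => (D.all ω).2.2) |>.ae hν')
    have h3 := Measure.quasiMeasurePreserving_snd (μ := uniformSphere (S.R k)) |>.ae
      (Measure.quasiMeasurePreserving_snd (μ := ν) |>.ae h.ae_interferers_nonneg)
    filter_upwards [h1, h2, h3] with p hp1 hp2 hp3
    exact propext (S.sinrAt_lt_iff k hβ hβγ hp1 hp2 hp3)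
  have hintB : Integrable (B.indicator fun _ => (1 : ℝ))
      ((uniformSphere (S.R k)).prod (ν.prod (P.map fun ω => (D.all ω).2.2))) :=
    (integrable_const 1).indicator hB
  have hreal : P.real {ω | D.sinr S k ω < β} = ∫ p, B.indicator (fun _ => (1 : ℝ)) p
      ∂((uniformSphere (S.R k)).prod (ν.prod (P.map fun ω => (D.all ω).2.2))) := by
    rw [integral_indicator_const _ hB, smul_eq_mul, mul_one, ← measureReal_congr hAB, ← h.map_all,
      map_measureReal_apply h.measurable_all hA]
    rfl
  rw [hreal, integral_prod _ hintB]
  refine integral_congr_ae (ae_of_all _ fun x => ?_)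
  have hBx : MeasurableSet (Prod.mk x ⁻¹' B) := measurable_prodMk_left hB
  have hintx : Integrable (fun z => B.indicator (fun _ => (1 : ℝ)) (x, z))
      (ν.prod (P.map fun ω => (D.all ω).2.2)) := by
    have : Integrable ((Prod.mk x ⁻¹' B).indicator fun _ => (1 : ℝ))
        (ν.prod (P.map fun ω => (D.all ω).2.2)) := (integrable_const 1).indicator hBx
    exact this
  dsimp only
  -- The order is exchanged so that the gain is integrated innermost, with position and interferers
  -- fixed.
  rw [integral_prod_symm _ hintx]
  refine integral_congr_ae (ae_of_all _ fun y => ?_)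
  dsimp only
  split_ifs with hc
  · have : (fun t => B.indicator (fun _ => (1 : ℝ)) (x, t, y)) =
        (Set.Iio (S.gainThreshold k β x y)).indicator fun _ => (1 : ℝ) := by
      funext t
      simp only [Set.indicator, B, Set.mem_ofPred_eq, Set.mem_Iio, hc, true_imp_iff]
    rw [this, integral_indicator_const _ measurableSet_Iio, smul_eq_mul, mul_one]
  · have : (fun t => B.indicator (fun _ => (1 : ℝ)) (x, t, y)) = fun _ => 1 := by
      funext t
      have : (x, t, y) ∈ B := fun hx => absurd hx hc
      exact Set.indicator_of_mem this _
    rw [this]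
    simp

/-- After the binomial expansion the inner integral consists of Laplace transforms of the
interference. It depends on `x` only through the angle with the typical device, whose density for a
uniform point is `sin θ / 2`. -/
theorem integral_approxCDF_gainThreshold [IsProbabilityMeasure P] (h : D.HasModelLaw S k ν P)
    {β : ℝ} (hβ : 0 < β) (hβγ : β * (1 - S.γ) < S.γ) :
    ∫ x, ∫ y, (if InnerProductGeometry.angle x S.typical < S.thetaMax k then
        S.approxCDF (S.gainThreshold k β x y) else 1)
      ∂(P.map fun ω => (D.all ω).2.2) ∂uniformSphere (S.R k) = S.tierFactor β k := by
  have := h.isProbabilityMeasure_interferers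
  rw [← S.integral_outageAt k hβ hβγ, ← integral_comp_angle_uniformSphere S.typical_ne_zero
    (S.R_pos k) (g := fun θ => if θ < S.thetaMax k then S.outageAt k β θ else 1)
    (Measurable.ite (measurableSet_lt measurable_id measurable_const) (S.measurable_outageAt k β)
      measurable_const)]
  refine integral_congr_ae ?_
  filter_upwards [ae_norm_uniformSphere S k] with x hx
  rw [InnerProductGeometry.angle_comm S.typical x]
  by_cases hc : InnerProductGeometry.angle x S.typical < S.thetaMax k
  · simp only [if_pos hc]
    simp_rw [Uplink.gainThreshold, S.dist_eq_distAt k hx S.norm_typical,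
      S.approxCDF_eq_sum k hβγ]
    rw [integral_finsetSum]
    · refine Finset.sum_congr rfl fun q _ => ?_
      rw [integral_const_mul, integral_const_mul, h.integral_exp_neg_interferenceAt hx
        (mul_nonneg q.cast_nonneg (S.sES_nonneg k hβ hβγ _))]
    · intro q _
      refine Integrable.const_mul (Integrable.const_mul ?_ _) _
      have hs := mul_nonneg (q.cast_nonneg (α := ℝ))
        (S.sES_nonneg k hβ hβγ (InnerProductGeometry.angle x S.typical))
      refine Integrable.of_bound (Measurable.aestronglyMeasurable ?_) 1 ?_
      · exact (((S.measurable_interferenceAt k).comp measurable_prodMk_left).const_mul _).neg.exp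
      · filter_upwards [h.ae_interferers_nonneg] with y hy
        rw [Real.norm_of_nonneg (Real.exp_pos _).le, Real.exp_le_one_iff, neg_nonpos]
        exact mul_nonneg hs (S.interferenceAt_nonneg k x hy)
  · simp [if_neg hc]

/-- The alternating sum hides the sign; the representation as an integral of values in `[0, 1]`
shows it. Multiplying the lower bounds over the eavesdroppers requires it. -/
theorem tierFactor_nonneg [IsProbabilityMeasure P] (h : D.HasModelLaw S k ν P)
    {β : ℝ} (hβ : 0 < β) (hβγ : β * (1 - S.γ) < S.γ) : 0 ≤ S.tierFactor β k := by
  rw [← h.integral_approxCDF_gainThreshold hβ hβγ]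
  refine integral_nonneg_of_ae ?_
  filter_upwards [ae_norm_uniformSphere S k] with x hx
  refine integral_nonneg_of_ae ?_
  filter_upwards [h.ae_interferers_nonneg] with y hy
  dsimp only [Pi.zero_apply]
  split_ifs
  · exact (S.approxCDF_mem_Icc (S.gainThreshold_pos k hβ hβγ hx hy).le).1
  · exact zero_le_one

theorem prob_sinr_lt_eq_tierFactor [IsProbabilityMeasure P] (h : D.HasModelLaw S k ν P)
    {β : ℝ} (hβ : 0 < β) (hβγ : β * (1 - S.γ) < S.γ) (hν0 : ν (Set.Iio 0) = 0)
    (hν : ∀ t, 0 < t → ν.real (Set.Iio t) = S.approxCDF t) :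
    P.real {ω | D.sinr S k ω < β} = S.tierFactor β k := by
  rw [h.prob_sinr_lt hβ hβγ hν0, ← h.integral_approxCDF_gainThreshold hβ hβγ]
  refine integral_congr_ae ?_
  filter_upwards [ae_norm_uniformSphere S k] with x hx
  refine integral_congr_ae ?_
  filter_upwards [h.ae_interferers_nonneg] with y hy
  rw [hν _ (S.gainThreshold_pos k hβ hβγ hx hy)]

theorem tierFactor_le_prob_sinr_lt [IsProbabilityMeasure P] (h : D.HasModelLaw S k ν P)
    {β : ℝ} (hβ : 0 < β) (hβγ : β * (1 - S.γ) < S.γ) (hν0 : ν (Set.Iio 0) = 0)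
    (hν : ∀ t, 0 < t → S.approxCDF t ≤ ν.real (Set.Iio t)) :
    S.tierFactor β k ≤ P.real {ω | D.sinr S k ω < β} := by
  have := h.isProbabilityMeasure_gain
  have := h.isProbabilityMeasure_uniformSphere
  have := h.isProbabilityMeasure_interferers
  have hcov : MeasurableSet {p : E3 × Interferers |
      InnerProductGeometry.angle p.1 S.typical < S.thetaMax k} :=
    measurableSet_lt (measurable_angle_comp measurable_fst measurable_const) measurable_const
  have hmono : Measurable fun t => ν.real (Set.Iio t) :=
    Monotone.measurable fun a b hab => measureReal_mono (Set.Iio_subset_Iio hab)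
  have hm1 : Measurable fun p : E3 × Interferers =>
      if InnerProductGeometry.angle p.1 S.typical < S.thetaMax k then
        ν.real (Set.Iio (S.gainThreshold k β p.1 p.2)) else 1 :=
    Measurable.ite hcov (hmono.comp (S.measurable_gainThreshold k β)) measurable_const
  have hm2 : Measurable fun p : E3 × Interferers =>
      if InnerProductGeometry.angle p.1 S.typical < S.thetaMax k then
        S.approxCDF (S.gainThreshold k β p.1 p.2) else 1 :=
    Measurable.ite hcov
      (S.continuous_approxCDF.measurable.comp (S.measurable_gainThreshold k β)) measurable_const
  have hae : ∀ᵐ p ∂(uniformSphere (S.R k)).prod (P.map fun ω => (D.all ω).2.2),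
      0 < S.gainThreshold k β p.1 p.2 := by
    have h1 := Measure.quasiMeasurePreserving_fst (μ := uniformSphere (S.R k))
      (ν := P.map fun ω => (D.all ω).2.2) |>.ae (ae_norm_uniformSphere S k)
    have h2 := Measure.quasiMeasurePreserving_snd (μ := uniformSphere (S.R k)) |>.ae
      h.ae_interferers_nonneg
    filter_upwards [h1, h2] with p hp1 hp2 using S.gainThreshold_pos k hβ hβγ hp1 hp2
  have hi1 : Integrable (fun p : E3 × Interferers =>
      if InnerProductGeometry.angle p.1 S.typical < S.thetaMax k then
        ν.real (Set.Iio (S.gainThreshold k β p.1 p.2)) else 1)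
      ((uniformSphere (S.R k)).prod (P.map fun ω => (D.all ω).2.2)) := by
    refine Integrable.of_bound hm1.aestronglyMeasurable 1 (ae_of_all _ fun p => ?_)
    split_ifs
    · rw [Real.norm_of_nonneg measureReal_nonneg]
      exact measureReal_le_one
    · simp
  have hi2 : Integrable (fun p : E3 × Interferers =>
      if InnerProductGeometry.angle p.1 S.typical < S.thetaMax k then
        S.approxCDF (S.gainThreshold k β p.1 p.2) else 1)
      ((uniformSphere (S.R k)).prod (P.map fun ω => (D.all ω).2.2)) := by
    refine Integrable.of_bound hm2.aestronglyMeasurable 1 ?_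
    filter_upwards [hae] with p hp
    have := S.approxCDF_mem_Icc hp.le
    split_ifs
    · rw [Real.norm_of_nonneg this.1]
      exact this.2
    · simp
  -- The iterated integrals are merged into integrals over the product, where a single almost
  -- everywhere comparison suffices.
  rw [h.prob_sinr_lt hβ hβγ hν0, ← h.integral_approxCDF_gainThreshold hβ hβγ,
    ← integral_prod _ hi1, ← integral_prod _ hi2]
  refine integral_mono_ae hi2 hi1 ?_
  filter_upwards [hae] with p hp
  split_ifs
  · exact hν _ hp
  · exact le_rfl

end HasModelLaw

end EveData

/-! ### All eavesdroppers -/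

/-- `cdf` measures closed half-lines, whereas the event `SINR < β` gives open ones; continuity at
`t` excludes an atom there. -/
theorem measureReal_Iio_of_continuousAt_cdf (ν : Measure ℝ) [IsProbabilityMeasure ν] {t : ℝ}
    (ht : ContinuousAt (cdf ν) t) : ν.real (Set.Iio t) = cdf ν t := by
  have h : ν (Set.Iio t) = ENNReal.ofReal (cdf ν t) := by
    conv_lhs => rw [← measure_cdf ν]
    rw [StieltjesFunction.measure_Iio _ (tendsto_cdf_atBot ν),
      ht.continuousWithinAt.leftLim_eq, sub_zero]
  rw [measureReal_def, h, ENNReal.toReal_ofReal (cdf_nonneg ν t)]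

namespace Uplink

variable {K : ℕ} (S : Uplink K)

theorem approxCDF_zero : S.approxCDF 0 = 0 := by
  have := S.m₁_pos
  simp [approxCDF, (show S.m₁ ≠ 0 by omega)]

/-- The distribution function is prescribed only on `x ≥ 0`; its value 0 at the origin already rules
out negative gains. -/
theorem measure_Iio_zero_of_cdf_eq {ν : Measure ℝ} [IsProbabilityMeasure ν]
    (hν : ∀ x : ℝ, 0 ≤ x → cdf ν x = S.approxCDF x) : ν (Set.Iio 0) = 0 := by
  refine measure_mono_null Set.Iio_subset_Iic_self ?_
  rw [← ofReal_cdf ν 0, hν 0 le_rfl, S.approxCDF_zero, ENNReal.ofReal_zero]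

theorem measureReal_Iio_of_cdf_eq {ν : Measure ℝ} [IsProbabilityMeasure ν]
    (hν : ∀ x : ℝ, 0 ≤ x → cdf ν x = S.approxCDF x) {t : ℝ} (ht : 0 < t) :
    ν.real (Set.Iio t) = S.approxCDF t := by
  rw [measureReal_Iio_of_continuousAt_cdf, hν t ht.le]
  refine S.continuous_approxCDF.continuousAt.congr ?_
  filter_upwards [lt_mem_nhds ht] with x hx using (hν x hx.le).symm

theorem approxCDF_le_gammaFading {t : ℝ} (ht : 0 < t) :
    S.approxCDF t ≤ S.gammaFading.real (Set.Iio t) := by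
  have hm : (0 : ℝ) < S.m₁ := by exact_mod_cast S.m₁_pos
  have hr : 0 < 1 / S.m₂ := one_div_pos.2 S.m₂_pos
  have := isProbabilityMeasure_gammaMeasure hm hr
  rw [gammaFading, measureReal_Iio_of_continuousAt_cdf _
    (hasDerivAt_cdf_gammaMeasure hm hr ht).continuousAt]
  exact pow_one_sub_exp_le_cdf_gammaMeasure S.m₁_pos S.m₂_pos ht.le

theorem cdf_gammaFading_of_shape_one (h1 : S.m₁ = 1) {x : ℝ} (hx : 0 ≤ x) :
    cdf S.gammaFading x = S.approxCDF x := by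
  rw [gammaFading, approxCDF, h1, Nat.cast_one, cdf_gammaMeasure_one (one_div_pos.2 S.m₂_pos) hx]
  simp

theorem maxSINR_lt_iff {Ω : Type*} (D : S.Eve → EveData Ω) (β : ℝ) (ω : Ω) :
    S.maxSINR D ω < (β : EReal) ↔ ∀ e, (D e).sinr S (S.tier e) ω < β := by
  rw [maxSINR, Finset.sup_lt_iff (EReal.bot_lt_coe β)]
  simp

theorem prod_eve (f : Fin K → ℝ) :
    ∏ e : S.Eve, f (S.tier e) = ∏ k ∈ Finset.univ.erase S.legit, f k ^ S.num k := by
  rw [Fintype.prod_sigma,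
    Finset.prod_subtype (p := fun k => k ≠ S.legit) (F := inferInstance) _ (by simp)]
  simp [tier]

/-- A maximum is below `β` exactly when every SINR is. Each of these events is a measurable
condition on `(D e).all`, so independence of the families applies. With no eavesdropper the maximum
is `⊥` and the product is empty. -/
theorem outageProb_eq_prod {Ω : Type*} [MeasurableSpace Ω] {P : Measure Ω}
    {D : S.Eve → EveData Ω} (hind : S.EavesdroppersIndep P D) (β : ℝ) :
    S.outageProb P D β = ∏ e, P.real {ω | (D e).sinr S (S.tier e) ω < β} := by
  have hA (k : Fin K) : MeasurableSet {p : E3 × ℝ × Interferers |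
      S.sinrAt k p.1 p.2.1 p.2.2 < β} :=
    measurableSet_lt (S.measurable_sinrAt k) measurable_const
  have h := hind.measure_inter_preimage_eq_mul Finset.univ
    (sets := fun e => {p | S.sinrAt (S.tier e) p.1 p.2.1 p.2.2 < β}) fun e _ => hA (S.tier e)
  have hset : {ω | S.maxSINR D ω < (β : EReal)} = ⋂ e ∈ Finset.univ,
      (D e).all ⁻¹' {p | S.sinrAt (S.tier e) p.1 p.2.1 p.2.2 < β} := by
    ext ω
    simp only [Set.mem_ofPred_eq, S.maxSINR_lt_iff, Finset.mem_univ, Set.iInter_true,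
      Set.mem_iInter, Set.mem_preimage]
    rfl
  rw [outageProb, measureReal_def, hset, h, ENNReal.toReal_prod]
  rfl

end Uplink

end

theorem theorem1 {Ω : Type*} [MeasurableSpace Ω] (P : Measure Ω) [IsProbabilityMeasure P]
    {K : ℕ} (S : Uplink K) (β : ℝ) (hβ : 0 < β) (hβγ : β * (1 - S.γ) < S.γ)
    (ν : Measure ℝ) (D : S.Eve → EveData Ω)
    (hD : ∀ e, (D e).HasModelLaw S (S.tier e) ν P) :
    -- the typical device's gain has the approximating distribution function
    ((∀ x : ℝ, 0 ≤ x → cdf ν x = S.approxCDF x) →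
      (∀ e, P.real {ω | (D e).sinr S (S.tier e) ω < β} = S.tierFactor β (S.tier e)) ∧
      (S.EavesdroppersIndep P D → S.outageProb P D β = S.outageFormula β)) ∧
    -- the typical device's gain is Gamma distributed
    (ν = S.gammaFading →
      (∀ e, S.tierFactor β (S.tier e) ≤ P.real {ω | (D e).sinr S (S.tier e) ω < β}) ∧
      (S.EavesdroppersIndep P D → S.outageFormula β ≤ S.outageProb P D β) ∧
      (S.m₁ = 1 →
        (∀ e, P.real {ω | (D e).sinr S (S.tier e) ω < β} = S.tierFactor β (S.tier e)) ∧
        (S.EavesdroppersIndep P D → S.outageProb P D β = S.outageFormula β))) := by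

  have hout (heq : ∀ e, P.real {ω | (D e).sinr S (S.tier e) ω < β} = S.tierFactor β (S.tier e))
      (hind : S.EavesdroppersIndep P D) : S.outageProb P D β = S.outageFormula β := by
    rw [S.outageProb_eq_prod hind, Finset.prod_congr rfl fun e _ => heq e,
      S.prod_eve (S.tierFactor β), Uplink.outageFormula]
  have hcdf (hν : ∀ x : ℝ, 0 ≤ x → cdf ν x = S.approxCDF x) (e : S.Eve) :
      P.real {ω | (D e).sinr S (S.tier e) ω < β} = S.tierFactor β (S.tier e) := by
    have := (hD e).isProbabilityMeasure_gain
    exact (hD e).prob_sinr_lt_eq_tierFactor hβ hβγ (S.measure_Iio_zero_of_cdf_eq hν)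
      fun t ht => S.measureReal_Iio_of_cdf_eq hν ht
  refine ⟨fun hν => ⟨hcdf hν, hout (hcdf hν)⟩, ?_⟩
  rintro rfl
  have hle (e : S.Eve) :
      S.tierFactor β (S.tier e) ≤ P.real {ω | (D e).sinr S (S.tier e) ω < β} :=
    (hD e).tierFactor_le_prob_sinr_lt hβ hβγ (gammaMeasure_Iio_zero _ _)
      fun t ht => S.approxCDF_le_gammaFading ht
  refine ⟨hle, fun hind => ?_, fun h1 => ?_⟩
  · rw [S.outageProb_eq_prod hind, Uplink.outageFormula, ← S.prod_eve (S.tierFactor β)]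
    exact Finset.prod_le_prod (fun e _ => (hD e).tierFactor_nonneg hβ hβγ) fun e _ => hle e
  · have h2 := hcdf fun x hx => S.cdf_gammaFading_of_shape_one h1 hx
    exact ⟨h2, hout h2⟩
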